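/- Let $A$ be an irreducible $k\times k$ matrix with entries in $\mathbb Z_{\ge 0}$, let $(X_A,\sigma_A)$ be the associated two-sided edge shift of finite type, and assume that it has positive topological entropy. Let $\mathrm{Aut}(\sigma_A)$ be the group of homeomorphisms of $X_A$ commuting with $\sigma_A$. *Range distortion.* For $\phi\in\mathrm{Aut}(\sigma_A)$ and $S,T\subset\mathbb Z$ say that $S$ $\phi$-codes $T$ if $x|_S=y|_S$ implies $\phi(x)|_T=\phi(y)|_T$ for all $x,y\in X_A$. Put $$W^-(n,\phi)=\sup\{m\in\mathbb Z : (-\infty,0]\ \phi^n\text{-codes}\ (-\infty,m]\},\qquad W^+(n,\phi)=\inf\{m\in\mathbb Z : [0,\infty)\ \phi^n\text{-codes}\ [m,\infty)\},$$ $$\alpha^\pm(\phi)=\lim_{n\to\infty}\frac{W^\pm(n,\phi)}{n}.$$ The automorphism $\phi$ is called range distorted if $\alpha^-(\phi)=\alpha^+(\phi)=0$. *Dimension representation.* With matrices acting on row vectors, let $R(A)=\mathbb Q^kA^k$, $$\mathcal G_A=\{x\in R(A): xA^n\in\mathbb Z^k\text{ for some }n\ge 0\},\quad \mathcal G_A^+=\{x\in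 R(A): xA^n\in\mathbb Z_{\ge0}^k\text{ for some }n\ge 0\},\quad \delta_A(x)=xA.$$ An $m$-ray is a set $R(x,m)=\{y\in X_A: y_i=x_i\text{ for all } i\le m\}$ with $x\in X_A$, and an $m$-beam is a finite union of $m$-rays. For an $m$-beam $U$ let $v_{U,m}\in\mathbb Z^k$ be the vector whose $J$-th entry is the number of distinct $m$-rays $R(x,m)$ in $U$ whose edge $x_m$ ends at the vertex $J$. Beams $U,V$ are equivalent if for some $m$ both are $m$-beams and $v_{U,m}=v_{V,m}$; write $[U]$ for the class of $U$. Let $D_A^+$ be the semigroup of classes of beams, with $[U]+[V]=[U\cup V]$ whenever $U\cap V=\emptyset$, let $D_A$ be its group completion, and let $\theta\colon D_A\to\mathcal G_A$ be the isomorphism induced by $\theta([U])=\delta_A^{-k-n}(v_{U,n}A^k)$ for an $n$-beam $U$. For $\phi\in\mathrm{Aut}(\sigma_A)$ let $\phi_*\colon D_A\to D_A$ be induced by $[U]\mapsto[\phi(U)]$. The dimension representation is $$\pi_A\colon\mathrm{Aut}(\sigma_A)\to\mathrm{Aut}(\mathcal G_A,\mathcal G_A^+,\delta_A),\qquad \pi_A(\phi)=S_\phi=\theta\circ\phi_*\circ\theta^{-1}.$$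 **Theorem.** Let $\phi\in\mathrm{Aut}(\sigma_A)$. If both $\phi$ and $\phi^{-1}$ are range distorted, then every eigenvalue of $\pi_A(\phi)=S_\phi$, that is, of the complex linear map $S_\phi\otimes 1\colon\mathcal G_A\otimes_{\mathbb Z}\mathbb C\to\mathcal G_A\otimes_{\mathbb Z}\mathbb C$, lies on the unit circle $\{\mu\in\mathbb C:|\mu|=1\}$. -/

import Mathlib

/-!
# Edge shifts, the dimension triple, the dimension representation, range distortion

`A` is always a `k × k` matrix over the nonnegative integers; matrices act on row vectors.
-/

noncomputable section

namespace EdgeShift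

variable {k : ℕ}

/-! ## The edge shift `(X_A, σ_A)` -/

/-- The edges of the directed graph with vertex set `Fin k` and `A i j` edges from `i` to `j`. -/
@[ext] structure Edge (A : Matrix (Fin k) (Fin k) ℕ) where
  src : Fin k
  tgt : Fin k
  lbl : Fin (A src tgt)

/-- The finite alphabet of edges is discrete. -/
instance (A : Matrix (Fin k) (Fin k) ℕ) : UniformSpace (Edge A) := ⊥

instance (A : Matrix (Fin k) (Fin k) ℕ) : DiscreteTopology (Edge A) := ⟨rfl⟩

instance (A : Matrix (Fin k) (Fin k) ℕ) : Finite (Edge A) :=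
  haveI : ∀ i j, Finite (Fin (A i j)) := fun i j => Finite.of_fintype _
  Finite.of_injective (β := Σ i : Fin k, Σ j : Fin k, Fin (A i j))
    (fun e => ⟨e.src, e.tgt, e.lbl⟩) (by
      rintro ⟨a, b, c⟩ ⟨a', b', c'⟩ h
      simp only [Sigma.mk.injEq] at h
      obtain ⟨rfl, h⟩ := h
      have h := eq_of_heq h
      simp only [Sigma.mk.injEq] at h
      obtain ⟨rfl, h⟩ := h
      cases h
      rfl)

/-- The space `X_A` of bi-infinite paths, with the topology (and uniformity) induced from the
product `(Edge A) ^ ℤ`. -/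
abbrev X (A : Matrix (Fin k) (Fin k) ℕ) : Type :=
  {x : ℤ → Edge A // ∀ i, (x i).tgt = (x (i + 1)).src}

/-- The shift map `σ_A`, `(σ x) i = x (i + 1)`. -/
def shift (A : Matrix (Fin k) (Fin k) ℕ) : X A ≃ₜ X A where
  toFun x := ⟨fun i => x.1 (i + 1), fun i => x.2 (i + 1)⟩
  invFun x := ⟨fun i => x.1 (i - 1), fun i => by
    have h := x.2 (i - 1)
    rwa [show i - 1 + 1 = i + 1 - 1 by ring] at h⟩
  left_inv x := by ext1; funext i; simp
  right_inv x := by ext1; funext i; simp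
  continuous_toFun := by
    refine Continuous.subtype_mk (continuous_pi fun i => ?_) _
    exact (continuous_apply (i + 1)).comp continuous_subtype_val
  continuous_invFun := by
    refine Continuous.subtype_mk (continuous_pi fun i => ?_) _
    exact (continuous_apply (i - 1)).comp continuous_subtype_val

/-- The automorphism group of `(X_A, σ_A)`: the homeomorphisms of `X_A` that commute with `σ_A`. -/
abbrev ShiftAut (A : Matrix (Fin k) (Fin k) ℕ) : Subgroup (X A ≃ₜ X A) :=
  Subgroup.centralizer {shift A}

/-- The standing assumptions: `A` is irreducible and the topological entropy of `(X_A, σ_A)` is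
positive. -/
class IrredPosEntropy (A : Matrix (Fin k) (Fin k) ℕ) : Prop where
  irreducible : (A.map (Nat.cast : ℕ → ℤ)).IsIrreducible
  entropy_pos : 0 < Dynamics.coverEntropy (shift A) Set.univ

variable {A : Matrix (Fin k) (Fin k) ℕ}

/-! ## Range distortion -/

/-- `S` `φ`-codes `T`: the coordinates of `x` in `S` determine the coordinates of `φ x` in `T`. -/
def Codes (φ : X A → X A) (S T : Set ℤ) : Prop :=
  ∀ x y : X A, (∀ i ∈ S, x.1 i = y.1 i) → ∀ j ∈ T, (φ x).1 j = (φ y).1 j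

/-- `C⁻(φ)`: the set of `m` such that `(-∞, 0]` `φ`-codes `(-∞, m]`. -/
def CMinus (φ : X A → X A) : Set ℤ := {m | Codes φ (Set.Iic 0) (Set.Iic m)}

/-- `C⁺(φ)`: the set of `m` such that `[0, ∞)` `φ`-codes `[m, ∞)`. -/
def CPlus (φ : X A → X A) : Set ℤ := {m | Codes φ (Set.Ici 0) (Set.Ici m)}

/-- `W⁻(n, φ) = sup C⁻(φⁿ)`, as an extended real number. -/
def WMinus (n : ℕ) (φ : ShiftAut A) : EReal :=
  sSup ((fun m : ℤ => ((m : ℝ) : EReal)) '' CMinus ⇑(φ ^ n : ShiftAut A).1)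

/-- `W⁺(n, φ) = inf C⁺(φⁿ)`, as an extended real number. -/
def WPlus (n : ℕ) (φ : ShiftAut A) : EReal :=
  sInf ((fun m : ℤ => ((m : ℝ) : EReal)) '' CPlus ⇑(φ ^ n : ShiftAut A).1)

/-- The Lyapunov exponent `α⁻(φ) = lim W⁻(n, φ) / n` exists and equals `a`. -/
def HasLyapunovMinus (φ : ShiftAut A) (a : EReal) : Prop :=
  Filter.Tendsto (fun n : ℕ => WMinus n φ / (n : EReal)) Filter.atTop (nhds a)

/-- The Lyapunov exponent `α⁺(φ) = lim W⁺(n, φ) / n` exists and equals `a`. -/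
def HasLyapunovPlus (φ : ShiftAut A) (a : EReal) : Prop :=
  Filter.Tendsto (fun n : ℕ => WPlus n φ / (n : EReal)) Filter.atTop (nhds a)

/-- `φ` is range distorted: `α⁻(φ) = α⁺(φ) = 0`. -/
def RangeDistorted (φ : ShiftAut A) : Prop :=
  HasLyapunovMinus φ 0 ∧ HasLyapunovPlus φ 0

/-! ## The dimension triple `(G_A, G_A⁺, δ_A)` -/

/-- `A` as a rational matrix. -/
abbrev ratMat (A : Matrix (Fin k) (Fin k) ℕ) : Matrix (Fin k) (Fin k) ℚ := A.map Nat.cast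

open scoped Matrix

/-- The eventual range `R(A) = ℚᵏ Aᵏ`. -/
def eventualRange (A : Matrix (Fin k) (Fin k) ℕ) : Submodule ℚ (Fin k → ℚ) :=
  LinearMap.range (Matrix.vecMulLinear (ratMat A ^ k))

theorem cast_vecMul_pow (u : Fin k → ℤ) (p : ℕ) : (fun i => (u i : ℚ)) ᵥ* ratMat A ^ p =
    fun i => (((u ᵥ* (A.map (Nat.cast : ℕ → ℤ)) ^ p) i : ℤ) : ℚ) := by
  have h := RingHom.map_vecMul (Int.castRingHom ℚ) ((A.map (Nat.cast : ℕ → ℤ)) ^ p) u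
  have h2 : ((A.map (Nat.cast : ℕ → ℤ)) ^ p).map (Int.castRingHom ℚ) = ratMat A ^ p := by
    rw [Matrix.map_pow]
    rfl
  funext i
  rw [← h2]
  exact (h i).symm

/-- `G_A = {x ∈ R(A) | x Aⁿ ∈ ℤᵏ for some n ≥ 0}`. -/
def dimSubgroup (A : Matrix (Fin k) (Fin k) ℕ) : AddSubgroup (Fin k → ℚ) where
  carrier := {x | x ∈ eventualRange A ∧
    ∃ n : ℕ, ∃ z : Fin k → ℤ, x ᵥ* ratMat A ^ n = fun i => (z i : ℚ)}
  zero_mem' := ⟨Submodule.zero_mem _, 0, 0, by ext; simp⟩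
  add_mem' := by
    rintro x y ⟨hx, n, z, hz⟩ ⟨hy, m, w, hw⟩
    refine ⟨Submodule.add_mem _ hx hy, n + m,
      z ᵥ* (A.map (Nat.cast : ℕ → ℤ)) ^ m + w ᵥ* (A.map (Nat.cast : ℕ → ℤ)) ^ n, ?_⟩
    rw [Matrix.add_vecMul]
    nth_rewrite 2 [add_comm n m]
    rw [pow_add, pow_add, ← Matrix.vecMul_vecMul, ← Matrix.vecMul_vecMul, hz, hw, cast_vecMul_pow,
      cast_vecMul_pow]
    ext i
    simp
  neg_mem' := by
    rintro x ⟨hx, n, z, hz⟩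
    exact ⟨Submodule.neg_mem _ hx, n, -z, by rw [Matrix.neg_vecMul, hz]; ext; simp⟩

/-- The dimension group `G_A`. -/
abbrev DimGroup (A : Matrix (Fin k) (Fin k) ℕ) : Type := dimSubgroup A

/-- The positive cone `G_A⁺ = {x ∈ R(A) | x Aⁿ ∈ (ℤ₊)ᵏ for some n ≥ 0}`. -/
def dimPos (A : Matrix (Fin k) (Fin k) ℕ) : Set (DimGroup A) :=
  {x | ∃ n : ℕ, ∃ z : Fin k → ℕ, (x : Fin k → ℚ) ᵥ* ratMat A ^ n = fun i => (z i : ℚ)}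

theorem vecMulLinear_pow (n : ℕ) :
    (Matrix.vecMulLinear (ratMat A) : Module.End ℚ (Fin k → ℚ)) ^ n
      = Matrix.vecMulLinear (ratMat A ^ n) := by
  induction n with
  | zero => ext; simp
  | succ n ih =>
    rw [pow_succ', ih]
    apply LinearMap.ext
    intro x
    rw [Module.End.mul_apply, Matrix.vecMulLinear_apply, Matrix.vecMulLinear_apply,
      Matrix.vecMulLinear_apply, Matrix.vecMul_vecMul, pow_succ]

theorem vecMul_eq_zero_of_succ {x : Fin k → ℚ} {n : ℕ} (h : x ᵥ* ratMat A ^ n = 0) :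
    x ᵥ* ratMat A ^ k = 0 := by
  have h1 := Module.End.ker_pow_le_ker_pow_finrank
    (Matrix.vecMulLinear (ratMat A) : Module.End ℚ (Fin k → ℚ)) n
  rw [Module.finrank_fin_fun, vecMulLinear_pow, vecMulLinear_pow] at h1
  exact h1 (show x ∈ LinearMap.ker _ from h)

theorem eventualRange_vecMul {x : Fin k → ℚ} (hx : x ∈ eventualRange A) :
    x ᵥ* ratMat A ∈ eventualRange A := by
  obtain ⟨y, rfl⟩ := hx
  refine ⟨y ᵥ* ratMat A, ?_⟩
  simp only [Matrix.vecMulLinear_apply, Matrix.vecMul_vecMul]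
  rw [← pow_succ, ← pow_succ']

theorem eventualRange_inj {x : Fin k → ℚ} (hx : x ∈ eventualRange A) (h : x ᵥ* ratMat A = 0) :
    x = 0 := by
  obtain ⟨y, rfl⟩ := hx
  simp only [Matrix.vecMulLinear_apply, Matrix.vecMul_vecMul] at h ⊢
  rw [← pow_succ] at h
  exact vecMul_eq_zero_of_succ h

theorem eventualRange_surj {x : Fin k → ℚ} (hx : x ∈ eventualRange A) :
    ∃ y ∈ eventualRange A, y ᵥ* ratMat A = x := by
  let T : eventualRange A →ₗ[ℚ] eventualRange A :=
    (Matrix.vecMulLinear (ratMat A)).restrict fun x hx => eventualRange_vecMul hx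
  have hT : Function.Injective T := by
    rw [injective_iff_map_eq_zero]
    intro a ha
    have := eventualRange_inj a.2 (congrArg Subtype.val ha)
    exact Subtype.ext this
  obtain ⟨y, hy⟩ := LinearMap.injective_iff_surjective.1 hT ⟨x, hx⟩
  exact ⟨y, y.2, congrArg Subtype.val hy⟩

/-- The map `x ↦ x A` as an endomorphism of `G_A`. -/
def deltaHom (A : Matrix (Fin k) (Fin k) ℕ) : DimGroup A →+ DimGroup A where
  toFun x := ⟨x.1 ᵥ* ratMat A, eventualRange_vecMul x.2.1, by
    obtain ⟨n, z, hz⟩ := x.2.2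
    refine ⟨n, z ᵥ* (A.map (Nat.cast : ℕ → ℤ)), ?_⟩
    have h := cast_vecMul_pow (A := A) z 1
    rw [pow_one, pow_one] at h
    rw [← h, ← hz, Matrix.vecMul_vecMul, Matrix.vecMul_vecMul, ← pow_succ, ← pow_succ']⟩
  map_zero' := by
    apply Subtype.ext
    change ((0 : DimGroup A) : Fin k → ℚ) ᵥ* ratMat A = ((0 : DimGroup A) : Fin k → ℚ)
    simp
  map_add' x y := by
    apply Subtype.ext
    change ((x + y : DimGroup A) : Fin k → ℚ) ᵥ* ratMat A = x.1 ᵥ* ratMat A + y.1 ᵥ* ratMat A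
    simp [Matrix.add_vecMul]

/-- The automorphism `δ_A(x) = x A` of `G_A`. -/
def delta (A : Matrix (Fin k) (Fin k) ℕ) : DimGroup A ≃ₗ[ℤ] DimGroup A :=
  LinearEquiv.ofBijective (deltaHom A).toIntLinearMap
    (by
      constructor
      · rw [injective_iff_map_eq_zero]
        intro a ha
        exact Subtype.ext (eventualRange_inj a.2.1 (congrArg Subtype.val ha))
      · intro x
        obtain ⟨y, hy, hyx⟩ := eventualRange_surj x.2.1
        obtain ⟨n, z, hz⟩ := x.2.2
        refine ⟨⟨y, hy, n + 1, z, ?_⟩, Subtype.ext hyx⟩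
        rw [pow_succ', ← Matrix.vecMul_vecMul, hyx, hz])

theorem delta_coe (x : DimGroup A) : (delta A x : Fin k → ℚ) = x.1 ᵥ* ratMat A := rfl

theorem delta_pow_coe (n : ℕ) (x : DimGroup A) :
    (((delta A) ^ n) x : Fin k → ℚ) = x.1 ᵥ* ratMat A ^ n := by
  induction n with
  | zero => simp
  | succ n ih =>
    rw [pow_succ', LinearEquiv.mul_apply, delta_coe, ih, Matrix.vecMul_vecMul, pow_succ]

/-- The group `Aut(G_A, G_A⁺, δ_A)`: the group automorphisms of `G_A` that map `G_A⁺` onto `G_A⁺`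
and commute with `δ_A`. -/
def DimAut (A : Matrix (Fin k) (Fin k) ℕ) : Subgroup (DimGroup A ≃ₗ[ℤ] DimGroup A) where
  carrier := {Φ | Φ '' dimPos A = dimPos A ∧ Φ * delta A = delta A * Φ}
  one_mem' := ⟨by simp, by simp⟩
  mul_mem' := by
    rintro Φ Ψ ⟨h1, h2⟩ ⟨h3, h4⟩
    refine ⟨?_, ?_⟩
    · rw [show (⇑(Φ * Ψ)) = Φ ∘ Ψ from rfl, Set.image_comp, h3, h1]
    · rw [mul_assoc, h4, ← mul_assoc, h2, mul_assoc]
  inv_mem' := by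
    rintro Φ ⟨h1, h2⟩
    refine ⟨?_, (Commute.inv_left (show Commute Φ (delta A) from h2)).eq⟩
    conv_lhs => rw [← h1]
    rw [← Set.image_comp]
    have : (⇑Φ⁻¹ ∘ ⇑Φ) = id := by
      funext x
      exact Φ.symm_apply_apply x
    rw [this, Set.image_id]

/-- For an integer row vector `v`, the element `v Aᵏ` of `G_A`. -/
def ofVec (A : Matrix (Fin k) (Fin k) ℕ) : (Fin k → ℤ) →+ DimGroup A where
  toFun v := ⟨(fun i => (v i : ℚ)) ᵥ* ratMat A ^ k, ⟨_, rfl⟩, 0,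
    v ᵥ* (A.map (Nat.cast : ℕ → ℤ)) ^ k, by rw [pow_zero, Matrix.vecMul_one, cast_vecMul_pow]⟩
  map_zero' := by
    ext1
    change (fun i => (((0 : Fin k → ℤ) i : ℤ) : ℚ)) ᵥ* ratMat A ^ k = 0
    rw [show (fun i => (((0 : Fin k → ℤ) i : ℤ) : ℚ)) = 0 by ext; simp, Matrix.zero_vecMul]
  map_add' v w := by
    ext1
    change (fun i => (((v + w) i : ℤ) : ℚ)) ᵥ* ratMat A ^ k
      = (fun i => (v i : ℚ)) ᵥ* ratMat A ^ k + (fun i => (w i : ℚ)) ᵥ* ratMat A ^ k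
    rw [← Matrix.add_vecMul]
    congr 1
    ext i
    simp

/-! ## Rays and beams -/

/-- The `m`-ray `R(x, m)`: the points that agree with `x` on `(-∞, m]`. -/
def ray (x : X A) (m : ℤ) : Set (X A) := {y | ∀ i ≤ m, y.1 i = x.1 i}

/-- An `m`-beam is a finite union of `m`-rays. -/
def IsBeam (m : ℤ) (U : Set (X A)) : Prop :=
  ∃ s : Set (X A), s.Finite ∧ U = ⋃ x ∈ s, ray x m

/-- The distinct `m`-rays `R(x, m)` with `x ∈ U` for which the edge `x m` ends at the vertex `J`. -/
def raysIn (U : Set (X A)) (m : ℤ) (J : Fin k) : Set (Set (X A)) :=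
  (fun x => ray x m) '' {x | x ∈ U ∧ (x.1 m).tgt = J}

/-- The vector `v_{U,m}` of an `m`-beam `U`: its `J`-th component is the number of distinct `m`-rays
making up `U` whose `m`-th edge ends at `J`. -/
def beamVec (U : Set (X A)) (m : ℤ) : Fin k → ℕ := fun J => (raysIn U m J).ncard

/-- Beams `U`, `V` are equivalent if both are `m`-beams and `v_{U,m} = v_{V,m}` for some `m`. -/
def BeamEquiv (U V : Set (X A)) : Prop :=
  ∃ m : ℤ, IsBeam m U ∧ IsBeam m V ∧ beamVec U m = beamVec V m

theorem mem_ray {x y : X A} {m : ℤ} : y ∈ ray x m ↔ ∀ i ≤ m, y.1 i = x.1 i := Iff.rfl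

theorem self_mem_ray (x : X A) (m : ℤ) : x ∈ ray x m := fun _ _ => rfl

theorem ray_eq_iff {x y : X A} {m : ℤ} : ray x m = ray y m ↔ ∀ i ≤ m, x.1 i = y.1 i := by
  constructor
  · intro h
    have : x ∈ ray y m := h ▸ self_mem_ray x m
    exact this
  · intro h
    ext z
    constructor
    · intro hz i hi
      rw [hz i hi, h i hi]
    · intro hz i hi
      rw [hz i hi, h i hi]

theorem image_finite_and_ncard_le {α β γ : Type*} {f : α → β} {g : α → γ} {S : Set α}
    (hg : (g '' S).Finite) (h : ∀ x ∈ S, ∀ y ∈ S, g x = g y → f x = f y) :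
    (f '' S).Finite ∧ (f '' S).ncard ≤ (g '' S).ncard := by
  obtain ⟨s, hs, hb⟩ := Set.exists_subset_bijOn S g
  have hsf : s.Finite := Set.Finite.of_finite_image (hb.image_eq.symm ▸ hg) hb.injOn
  have e : f '' S = f '' s := by
    apply Set.Subset.antisymm
    · rintro _ ⟨x, hx, rfl⟩
      obtain ⟨y, hy, hxy⟩ := hb.surjOn ⟨x, hx, rfl⟩
      exact ⟨y, hy, h y (hs hy) x hx hxy⟩
    · exact Set.image_mono hs
  rw [e, ← hb.image_eq, hb.injOn.ncard_image]
  exact ⟨hsf.image f, Set.ncard_image_le hsf⟩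

theorem isBeam_iff {m : ℤ} {U : Set (X A)} :
    IsBeam m U ↔ (∀ x ∈ U, ray x m ⊆ U) ∧ ((fun x => ray x m) '' U).Finite := by
  constructor
  · rintro ⟨s, hs, rfl⟩
    have key : ∀ x ∈ ⋃ x ∈ s, ray x m, ∃ y ∈ s, ray x m = ray y m := by
      intro x hx
      simp only [Set.mem_iUnion] at hx
      obtain ⟨y, hy, hxy⟩ := hx
      exact ⟨y, hy, ray_eq_iff.2 hxy⟩
    constructor
    · intro x hx
      obtain ⟨y, hy, h⟩ := key x hx
      rw [h]
      exact Set.subset_biUnion_of_mem (u := fun x => ray x m) hy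
    · refine (hs.image fun x => ray x m).subset ?_
      rintro _ ⟨x, hx, rfl⟩
      obtain ⟨y, hy, h⟩ := key x hx
      exact ⟨y, hy, h.symm⟩
  · rintro ⟨h1, h2⟩
    obtain ⟨s, hs, hb⟩ := Set.exists_subset_bijOn U fun x => ray x m
    refine ⟨s, Set.Finite.of_finite_image (hb.image_eq.symm ▸ h2) hb.injOn, ?_⟩
    apply Set.Subset.antisymm
    · intro x hx
      obtain ⟨y, hy, hxy⟩ := hb.surjOn ⟨x, hx, rfl⟩
      refine Set.mem_biUnion hy ?_
      have hxy : ray y m = ray x m := hxy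
      rw [hxy]
      exact self_mem_ray x m
    · exact Set.iUnion₂_subset fun y hy => h1 y (hs hy)

theorem IsBeam.finite_raysIn {m : ℤ} {U : Set (X A)} (h : IsBeam m U) (J : Fin k) :
    (raysIn U m J).Finite :=
  (isBeam_iff.1 h).2.subset (Set.image_mono fun _ hx => hx.1)

theorem IsBeam.union {m : ℤ} {U V : Set (X A)} (hU : IsBeam m U) (hV : IsBeam m V) :
    IsBeam m (U ∪ V) := by
  obtain ⟨s, hs, rfl⟩ := hU
  obtain ⟨t, ht, rfl⟩ := hV
  exact ⟨s ∪ t, hs.union ht, by rw [Set.biUnion_union]⟩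

theorem isBeam_empty (m : ℤ) : IsBeam m (∅ : Set (X A)) := ⟨∅, Set.finite_empty, by simp⟩

theorem beamVec_empty (m : ℤ) : beamVec (∅ : Set (X A)) m = 0 := by
  funext J
  simp [beamVec, raysIn]

theorem ray_succ_iff (x y : X A) (m : ℤ) :
    ((ray x m, x.1 (m + 1)) = (ray y m, y.1 (m + 1))) ↔ ray x (m + 1) = ray y (m + 1) := by
  simp only [Prod.mk.injEq, ray_eq_iff]
  constructor
  · rintro ⟨h1, h2⟩ i hi
    rcases hi.lt_or_eq with h | rfl
    · exact h1 i (by omega)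
    · exact h2
  · intro h
    exact ⟨fun i hi => h i (by omega), h _ le_rfl⟩

theorem IsBeam.succ {m : ℤ} {U : Set (X A)} (h : IsBeam m U) : IsBeam (m + 1) U := by
  rw [isBeam_iff] at h ⊢
  obtain ⟨h1, h2⟩ := h
  constructor
  · intro x hx y hy
    exact h1 x hx fun i hi => hy i (by omega)
  · have hfin : ((fun x : X A => (ray x m, x.1 (m + 1))) '' U).Finite :=
      (h2.prod (Set.finite_univ (α := Edge A))).subset (by
        rintro _ ⟨x, hx, rfl⟩
        exact ⟨⟨x, hx, rfl⟩, trivial⟩)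
    refine (image_finite_and_ncard_le hfin fun x _ y _ hxy => ?_).1
    exact (ray_succ_iff x y m).1 hxy

theorem IsBeam.mono {m n : ℤ} {U : Set (X A)} (h : IsBeam m U) (hmn : m ≤ n) : IsBeam n U := by
  induction n, hmn using Int.leInduction with
  | base => exact h
  | succ n _ ih => exact ih.succ

theorem beamVec_union {m : ℤ} {U V : Set (X A)} (hU : IsBeam m U) (hV : IsBeam m V)
    (hd : Disjoint U V) : beamVec (U ∪ V) m = beamVec U m + beamVec V m := by
  funext J
  have h1 : raysIn (U ∪ V) m J = raysIn U m J ∪ raysIn V m J := by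
    rw [raysIn, raysIn, raysIn, ← Set.image_union]
    congr 1
    ext x
    simp only [Set.mem_union, Set.mem_ofPred_eq]
    tauto
  have h2 : Disjoint (raysIn U m J) (raysIn V m J) := by
    rw [Set.disjoint_left]
    rintro _ ⟨x, ⟨hx, -⟩, rfl⟩ ⟨y, ⟨hy, -⟩, hxy⟩
    have : y ∈ U := (isBeam_iff.1 hU).1 x hx (by
      have hxy : ray y m = ray x m := hxy
      exact hxy ▸ self_mem_ray y m)
    exact Set.disjoint_left.1 hd this hy
  rw [beamVec, h1, Set.ncard_union_eq h2 (hU.finite_raysIn J) (hV.finite_raysIn J)]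
  rfl

/-- The path that follows `x` up to time `m` and `y` afterwards. -/
def glue (x y : X A) (m : ℤ) (h : (x.1 m).tgt = (y.1 m).tgt) : X A :=
  ⟨fun i => if i ≤ m then x.1 i else y.1 i, fun i => by
    beta_reduce
    rcases lt_trichotomy i m with hi | rfl | hi
    · rw [if_pos hi.le, if_pos (by omega)]
      exact x.2 i
    · rw [if_pos le_rfl, if_neg (by omega), h]
      exact y.2 i
    · rw [if_neg (by omega), if_neg (by omega)]
      exact y.2 i⟩

theorem glue_le {x y : X A} {m : ℤ} (h : (x.1 m).tgt = (y.1 m).tgt) {i : ℤ} (hi : i ≤ m) :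
    (glue x y m h).1 i = x.1 i := if_pos hi

theorem glue_gt {x y : X A} {m : ℤ} (h : (x.1 m).tgt = (y.1 m).tgt) {i : ℤ} (hi : m < i) :
    (glue x y m h).1 i = y.1 i := if_neg (by omega)

theorem exists_out [hA : IrredPosEntropy A] (i : Fin k) : ∃ e : Edge A, e.src = i := by
  obtain ⟨p, hp⟩ := hA.irreducible.connected i i
  let _ := Matrix.toQuiver (A.map (Nat.cast : ℕ → ℤ))
  obtain ⟨c, p₁, p₂, h, hl⟩ := Quiver.Path.exists_eq_comp_of_le_length p
    (n := 1) (Nat.succ_le_of_lt hp)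
  cases p₁ with
  | nil => simp at hl
  | cons q e =>
    have h0 := Quiver.Path.eq_of_length_zero q (by simpa using hl)
    subst h0
    have he := e.down
    simp only [Matrix.map_apply, Nat.cast_pos] at he
    exact ⟨⟨_, _, ⟨0, he⟩⟩, rfl⟩

theorem exists_in [hA : IrredPosEntropy A] (i : Fin k) : ∃ e : Edge A, e.tgt = i := by
  obtain ⟨p, hp⟩ := hA.irreducible.connected i i
  let _ := Matrix.toQuiver (A.map (Nat.cast : ℕ → ℤ))
  cases p with
  | nil => simp at hp
  | cons q e =>
    have he := e.down
    simp only [Matrix.map_apply, Nat.cast_pos] at he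
    exact ⟨⟨_, _, ⟨0, he⟩⟩, rfl⟩

theorem exists_point [hA : IrredPosEntropy A] (e : Edge A) (m : ℤ) : ∃ x : X A, x.1 m = e := by
  choose o ho using exists_out (A := A)
  choose n hn using exists_in (A := A)
  let r : ℕ → Edge A := fun j => Nat.rec e (fun _ f => o f.tgt) j
  let l : ℕ → Edge A := fun j => Nat.rec e (fun _ f => n f.src) j
  let s : ℤ → Edge A := fun i => if 0 ≤ i then r i.toNat else l (-i).toNat
  have hs : ∀ i, (s i).tgt = (s (i + 1)).src := by
    intro i
    by_cases hi : 0 ≤ i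
    · obtain ⟨j, rfl⟩ := Int.eq_ofNat_of_zero_le hi
      have e1 : s j = r j := by simp [s]
      have e2 : s ((j : ℤ) + 1) = r (j + 1) := by
        simp only [s]
        rw [if_pos (by omega)]
        congr 1
      rw [e1, e2]
      exact (ho _).symm
    · obtain ⟨j, hj⟩ := Int.eq_ofNat_of_zero_le (show 0 ≤ -i - 1 by omega)
      obtain rfl : i = -(j : ℤ) - 1 := by omega
      have e1 : s (-(j : ℤ) - 1) = l (j + 1) := by
        simp only [s]
        rw [if_neg hi, show (-(-(j : ℤ) - 1)).toNat = j + 1 by omega]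
      have e2 : s (-(j : ℤ) - 1 + 1) = l j := by
        rcases Nat.eq_zero_or_pos j with rfl | hj'
        · simp [s, r, l]
        · simp only [s]
          rw [if_neg (by omega), show (-(-(j : ℤ) - 1 + 1)).toNat = j by omega]
      rw [e1, e2]
      exact hn _
  refine ⟨⟨fun i => s (i - m), fun i => ?_⟩, ?_⟩
  · have := hs (i - m)
    rwa [show i - m + 1 = i + 1 - m by ring] at this
  · simp [s, r]

theorem ncard_edges (I J : Fin k) : {e : Edge A | e.src = I ∧ e.tgt = J}.ncard = A I J := by
  have : {e : Edge A | e.src = I ∧ e.tgt = J} =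
      Set.range (fun l : Fin (A I J) => (⟨I, J, l⟩ : Edge A)) := by
    ext ⟨a, b, c⟩
    constructor
    · rintro ⟨rfl, rfl⟩
      exact ⟨c, rfl⟩
    · rintro ⟨l, hl⟩
      cases hl
      exact ⟨rfl, rfl⟩
  rw [this, ← Set.image_univ, Set.InjOn.ncard_image, Set.ncard_univ, Nat.card_fin]
  intro a _ b _ h
  simpa using h

theorem beamVec_succ [hA : IrredPosEntropy A] {m : ℤ} {U : Set (X A)} (hU : IsBeam m U) :
    beamVec U (m + 1) = beamVec U m ᵥ* A := by
  funext J
  have hU' := isBeam_iff.1 hU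
  let f : X A → Set (X A) × Edge A := fun x => (ray x m, x.1 (m + 1))
  have hf : ∀ x y, f x = f y ↔ ray x (m + 1) = ray y (m + 1) := fun x y => ray_succ_iff x y m
  have e1 : (raysIn U (m + 1) J).ncard
      = (f '' {x | x ∈ U ∧ (x.1 (m + 1)).tgt = J}).ncard := by
    have h1 := image_finite_and_ncard_le (f := f) (hU.succ.finite_raysIn J)
      fun x _ y _ h => (hf x y).2 h
    exact le_antisymm (image_finite_and_ncard_le h1.1 fun x _ y _ h => (hf x y).1 h).2 h1.2
  have e2 : f '' {x | x ∈ U ∧ (x.1 (m + 1)).tgt = J}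
      = ⋃ I, (raysIn U m I) ×ˢ {e : Edge A | e.src = I ∧ e.tgt = J} := by
    ext ⟨R, e⟩
    simp only [Set.mem_image, Set.mem_ofPred_eq, Set.mem_iUnion, Set.mem_prod, f, Prod.mk.injEq]
    constructor
    · rintro ⟨x, ⟨hx, hJ⟩, rfl, rfl⟩
      exact ⟨(x.1 m).tgt, ⟨x, ⟨hx, rfl⟩, rfl⟩, (x.2 m).symm, hJ⟩
    · rintro ⟨I, ⟨x, ⟨hx, hI⟩, rfl⟩, he, hJ⟩
      obtain ⟨z, hz⟩ := exists_point e (m + 1)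
      have hxz : (x.1 m).tgt = (z.1 m).tgt := by rw [z.2 m, hz, he, hI]
      have hg : glue x z m hxz ∈ ray x m := fun i hi => glue_le hxz hi
      have hg2 : (glue x z m hxz).1 (m + 1) = e := by rw [glue_gt hxz (by omega), hz]
      refine ⟨glue x z m hxz, ⟨hU'.1 x hx hg, by rw [hg2, hJ]⟩, ?_, hg2⟩
      exact ray_eq_iff.2 hg
  rw [beamVec, e1, e2, Set.ncard_iUnion_of_finite, finsum_eq_sum_of_fintype]
  · simp only [Set.ncard_prod, ncard_edges, Matrix.vecMul, dotProduct, beamVec]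
  · intro I
    exact (hU.finite_raysIn I).prod (Set.toFinite _)
  · intro I I' hII
    rw [Function.onFun, Set.disjoint_left]
    rintro ⟨R, e⟩ ⟨-, h, -⟩ ⟨-, h', -⟩
    exact hII (h.symm.trans h')

theorem beamVec_add [hA : IrredPosEntropy A] {m : ℤ} {U : Set (X A)} (hU : IsBeam m U) (n : ℕ) :
    beamVec U (m + n) = beamVec U m ᵥ* A ^ n := by
  induction n with
  | zero => simp
  | succ n ih =>
    rw [Nat.cast_succ, ← add_assoc, beamVec_succ (hU.mono (by omega)), ih, Matrix.vecMul_vecMul,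
      pow_succ]

theorem BeamEquiv.at_ge [hA : IrredPosEntropy A] {m n : ℤ} {U V : Set (X A)} (hU : IsBeam m U)
    (hV : IsBeam m V) (h : beamVec U m = beamVec V m) (hmn : m ≤ n) :
    beamVec U n = beamVec V n := by
  obtain ⟨j, hj⟩ := Int.eq_ofNat_of_zero_le (show 0 ≤ n - m by omega)
  obtain rfl : n = m + j := by omega
  rw [beamVec_add hU, beamVec_add hV, h]

theorem infinite_X [hA : IrredPosEntropy A] : Infinite (X A) := by
  by_contra hfin
  rw [not_infinite_iff_finite] at hfin
  have hpos := hA.entropy_pos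
  refine absurd hpos (not_lt.2 ?_)
  rcases isEmpty_or_nonempty (X A) with he | hne
  · rw [Set.univ_eq_empty_iff.2 he, Dynamics.coverEntropy_empty]
    exact bot_le
  have := Fintype.ofFinite (X A)
  refine iSup₂_le fun U hU => ?_
  have hc : ((Fintype.card (X A) : ℕ∞) : ENNReal) ≠ 0 := by
    simp
  have hc' : ((Fintype.card (X A) : ℕ∞) : ENNReal) ≠ ⊤ := by simp
  rw [← ExpGrowth.expGrowthSup_const hc hc']
  refine ExpGrowth.expGrowthSup_monotone fun n => ?_
  refine ENat.toENNReal_mono ?_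
  refine Dynamics.IsDynCoverOf.coverMincard_le_card (s := (Finset.univ : Finset (X A))) ?_
  intro x _
  refine ⟨x, by simp, ?_⟩
  simp only [Dynamics.dynEntourage, Set.mem_iInter]
  intro i _
  rw [Set.mem_preimage]
  have : ∀ (i : ℕ) (p : X A × X A), p.1 = p.2 →
      ((Prod.map (shift A) (shift A))^[i] p).1 = ((Prod.map (shift A) (shift A))^[i] p).2 := by
    intro i
    induction i with
    | zero => exact fun p hp => hp
    | succ i ih => exact fun p hp => ih _ (congrArg (shift A) hp)
  have h := this i (x, x) rfl
  have h' := refl_mem_uniformity hU (x := ((Prod.map (shift A) (shift A))^[i] (x, x)).1)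
  nth_rewrite 2 [h] at h'
  exact h'

theorem shift_apply (x : X A) (i : ℤ) : (shift A x).1 i = x.1 (i + 1) := rfl

theorem shift_symm_apply (x : X A) (i : ℤ) : ((shift A).symm x).1 i = x.1 (i - 1) := rfl

theorem raysIn_finite_of_edge [hA : IrredPosEntropy A] {m : ℤ} (e : Edge A)
    (h : (raysIn (Set.univ : Set (X A)) m e.tgt).Finite) :
    (raysIn (Set.univ : Set (X A)) m e.src).Finite := by
  obtain ⟨z, hz⟩ := exists_point e (m + 1)
  have hg : ∀ x : X A, (x.1 m).tgt = e.src → (x.1 m).tgt = (z.1 m).tgt := by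
    intro x hx
    rw [z.2 m, hz, hx]
  classical
  let g : X A → X A := fun x =>
    if hx : (x.1 m).tgt = e.src then shift A (glue x z m (hg x hx)) else x
  have hgm : ∀ x : X A, ∀ hx : (x.1 m).tgt = e.src, g x = shift A (glue x z m (hg x hx)) :=
    fun x hx => dif_pos hx
  refine (image_finite_and_ncard_le (g := fun x => ray (g x) m) (h.subset ?_) ?_).1
  · rintro _ ⟨x, ⟨-, hx⟩, rfl⟩
    refine ⟨g x, ⟨trivial, ?_⟩, rfl⟩
    rw [hgm x hx, shift_apply, glue_gt _ (by omega), hz]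
  · rintro x ⟨-, hx⟩ y ⟨-, hy⟩ hxy
    simp only [ray_eq_iff] at hxy ⊢
    intro i hi
    have := hxy (i - 1) (by omega)
    rwa [hgm x hx, hgm y hy, shift_apply, shift_apply, sub_add_cancel, glue_le _ hi,
      glue_le _ hi] at this

theorem raysIn_infinite [hA : IrredPosEntropy A] (m : ℤ) (J : Fin k) :
    (raysIn (Set.univ : Set (X A)) m J).Infinite := by
  intro hJ
  have hall : ∀ I, (raysIn (Set.univ : Set (X A)) m I).Finite := by
    intro I
    let _ := Matrix.toQuiver (A.map (Nat.cast : ℕ → ℤ))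
    obtain ⟨p, -⟩ := hA.irreducible.connected I J
    induction p with
    | nil => exact hJ
    | cons q e ih =>
      apply ih
      have he := e.down
      simp only [Matrix.map_apply, Nat.cast_pos] at he
      exact raysIn_finite_of_edge (⟨_, _, ⟨0, he⟩⟩ : Edge A) hJ
  have hfin : (Set.range fun x : X A => ray x m).Finite := by
    refine (Set.finite_iUnion hall).subset ?_
    rintro _ ⟨x, rfl⟩
    exact Set.mem_iUnion.2 ⟨(x.1 m).tgt, x, ⟨trivial, rfl⟩, rfl⟩
  let st : Setoid (X A) := Setoid.ker fun x : X A => ray x m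
  have hst : ∀ x y : X A, st x y ↔ ∀ i ≤ m, x.1 i = y.1 i := fun x y => ray_eq_iff
  have hq : Finite (Quotient st) := by
    have := hfin.to_subtype
    exact Finite.of_equiv _ (Setoid.quotientKerEquivRange fun x : X A => ray x m).symm
  let G : Quotient st → Quotient st := Quotient.map ((shift A).symm) (by
    intro x y hxy
    have hxy := (hst x y).1 hxy
    refine (hst _ _).2 fun i hi => ?_
    exact hxy (i - 1) (by omega))
  have hsurj : Function.Surjective G := by
    intro q
    induction q using Quotient.inductionOn with
    | h y => exact ⟨⟦shift A y⟧, by simp [G]⟩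
  have hinj : Function.Injective G := Finite.injective_iff_surjective.2 hsurj
  have step : ∀ x y : X A, (∀ i ≤ m, x.1 i = y.1 i) →
      ∀ i ≤ m, (shift A x).1 i = (shift A y).1 i := by
    intro x y hxy
    have : G ⟦shift A x⟧ = G ⟦shift A y⟧ := by
      simp only [G, Quotient.map_mk, Homeomorph.symm_apply_apply]
      exact Quotient.sound ((hst _ _).2 hxy)
    exact (hst _ _).1 (Quotient.exact (hinj this))
  have hall : ∀ (n : ℕ) (x y : X A), (∀ i ≤ m, x.1 i = y.1 i) → ∀ i ≤ m + n, x.1 i = y.1 i := by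
    intro n
    induction n with
    | zero => intro x y h; simpa using h
    | succ n ih =>
      intro x y h i hi
      have := ih _ _ (step x y h) (i - 1) (by push_cast at hi; omega)
      simpa [shift_apply] using this
  have : Function.Injective fun x : X A => ray x m := by
    intro x y hxy
    have hxy := ray_eq_iff.1 hxy
    apply Subtype.ext
    funext i
    exact hall (i - m).toNat x y hxy i (by omega)
  have hX : Finite (X A) := by
    have hfin' := hfin.to_subtype
    exact Finite.of_injective (Set.rangeFactorization fun x : X A => ray x m)
      (Set.rangeFactorization_injective.2 this)
  exact infinite_X.not_finite hX

/-- Every vector of nonnegative integers is realized by an `m`-beam that avoids a given one. -/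
theorem exists_beam [hA : IrredPosEntropy A] {m : ℤ} {V : Set (X A)} (hV : IsBeam m V)
    (w : Fin k → ℕ) : ∃ U : Set (X A), IsBeam m U ∧ Disjoint U V ∧ beamVec U m = w := by
  have hVf := (isBeam_iff.1 hV).2
  have h : ∀ J, ∃ t ⊆ raysIn (Set.univ : Set (X A)) m J \ ((fun x => ray x m) '' V),
      t.Finite ∧ t.ncard = w J := fun J =>
    ((raysIn_infinite m J).sdiff hVf).exists_subset_ncard_eq (w J)
  choose t ht htf htc using h
  let U : Set (X A) := {x | ray x m ∈ t (x.1 m).tgt}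
  have hrays : ∀ J, raysIn U m J = t J := by
    intro J
    ext R
    constructor
    · rintro ⟨x, ⟨hx, rfl⟩, rfl⟩
      exact hx
    · intro hR
      obtain ⟨⟨x, ⟨-, hx⟩, rfl⟩, -⟩ := ht J hR
      exact ⟨x, ⟨by change ray x m ∈ t (x.1 m).tgt; rw [hx]; exact hR, hx⟩, rfl⟩
  refine ⟨U, isBeam_iff.2 ⟨?_, ?_⟩, ?_, ?_⟩
  · intro x hx y hy
    change ray y m ∈ t (y.1 m).tgt
    rw [hy m le_rfl, ray_eq_iff.2 hy]
    exact hx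
  · refine (Set.finite_iUnion htf).subset ?_
    rintro _ ⟨x, hx, rfl⟩
    exact Set.mem_iUnion.2 ⟨_, hx⟩
  · rw [Set.disjoint_left]
    intro x hx hxV
    exact (ht _ hx).2 ⟨x, hxV, rfl⟩
  · funext J
    rw [beamVec, hrays, htc]

theorem BeamEquiv.symm {U V : Set (X A)} (h : BeamEquiv U V) : BeamEquiv V U := by
  obtain ⟨m, hU, hV, h⟩ := h
  exact ⟨m, hV, hU, h.symm⟩

theorem BeamEquiv.trans [hA : IrredPosEntropy A] {U V W : Set (X A)} (h : BeamEquiv U V)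
    (h' : BeamEquiv V W) : BeamEquiv U W := by
  obtain ⟨m, hU, hV, h⟩ := h
  obtain ⟨n, hV', hW, h'⟩ := h'
  refine ⟨max m n, hU.mono (le_max_left _ _), hW.mono (le_max_right _ _), ?_⟩
  rw [BeamEquiv.at_ge hU hV h (le_max_left _ _), BeamEquiv.at_ge hV' hW h' (le_max_right _ _)]

/-! ## The action of an automorphism on beams -/

theorem ShiftAut.comm (φ : ShiftAut A) (x : X A) : φ.1 (shift A x) = shift A (φ.1 x) := by
  have := Subgroup.mem_centralizer_singleton_iff.1 φ.2
  exact congrArg (fun f : X A ≃ₜ X A => f x) this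

theorem ShiftAut.comm_pow (φ : ShiftAut A) (x : X A) (n : ℕ) :
    φ.1 ((shift A)^[n] x) = (shift A)^[n] (φ.1 x) := by
  induction n generalizing x with
  | zero => rfl
  | succ n ih => rw [Function.iterate_succ_apply, ih, ShiftAut.comm, Function.iterate_succ_apply]

theorem shift_iterate_apply (x : X A) (n : ℕ) (i : ℤ) :
    ((shift A)^[n] x).1 i = x.1 (i + n) := by
  induction n generalizing x with
  | zero => simp
  | succ n ih =>
    rw [Function.iterate_succ_apply, ih, shift_apply]
    rw [show i + ((n + 1 : ℕ) : ℤ) = i + n + 1 by push_cast; ring]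

instance : CompactSpace (X A) := by
  refine isCompact_iff_compactSpace.1 (IsClosed.isCompact ?_)
  have : {x : ℤ → Edge A | ∀ i, (x i).tgt = (x (i + 1)).src}
      = ⋂ i, {x | (x i).tgt = (x (i + 1)).src} := by
    ext x
    simp
  change IsClosed {x : ℤ → Edge A | ∀ i, (x i).tgt = (x (i + 1)).src}
  rw [this]
  refine isClosed_iInter fun i => ?_
  refine isClosed_eq ?_ ?_
  · exact (continuous_of_discreteTopology (f := fun e : Edge A => e.tgt)).comp (continuous_apply i)
  · exact (continuous_of_discreteTopology (f := fun e : Edge A => e.src)).comp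
      (continuous_apply (i + 1))

/-- An automorphism is given by a block code of finite range. -/
theorem ShiftAut.exists_range (φ : ShiftAut A) : ∃ r : ℕ, ∀ (x y : X A) (i : ℤ),
    (∀ j, i - r ≤ j → j ≤ i + r → x.1 j = y.1 j) → (φ.1 x).1 i = (φ.1 y).1 i := by
  have h0 : ∃ r : ℕ, ∀ (x y : X A),
      (∀ j : ℤ, -(r : ℤ) ≤ j → j ≤ r → x.1 j = y.1 j) → (φ.1 x).1 0 = (φ.1 y).1 0 := by
    by_contra! hcon
    have hco : ∀ j : ℤ, Continuous fun x : X A => x.1 j := fun j =>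
      (continuous_apply j).comp continuous_subtype_val
    let K : ℕ → Set (X A × X A) := fun r =>
      {p | (∀ j : ℤ, -(r : ℤ) ≤ j → j ≤ r → p.1.1 j = p.2.1 j) ∧
        (φ.1 p.1).1 0 ≠ (φ.1 p.2).1 0}
    have hcl : ∀ r, IsClosed (K r) := by
      intro r
      have e : K r = (⋂ j : ℤ, ⋂ (_ : -(r : ℤ) ≤ j), ⋂ (_ : j ≤ r),
          {p : X A × X A | p.1.1 j = p.2.1 j}) ∩
          {p : X A × X A | (φ.1 p.1).1 0 = (φ.1 p.2).1 0}ᶜ := by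
        ext p
        simp [K]
      rw [e]
      refine IsClosed.inter ?_ ?_
      · refine isClosed_iInter fun j => isClosed_iInter fun _ => isClosed_iInter fun _ => ?_
        exact isClosed_eq ((hco j).comp continuous_fst) ((hco j).comp continuous_snd)
      · rw [isClosed_compl_iff]
        have hc1 : Continuous fun p : X A × X A => ((φ.1 p.1).1 0, (φ.1 p.2).1 0) :=
          (((hco 0).comp φ.1.continuous).comp continuous_fst).prodMk
            (((hco 0).comp φ.1.continuous).comp continuous_snd)
        exact (isOpen_discrete {q : Edge A × Edge A | q.1 = q.2}).preimage hc1
    obtain ⟨p, hp⟩ := IsCompact.nonempty_iInter_of_sequence_nonempty_isCompact_isClosed K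
      (fun r p hp => ⟨fun j h1 h2 => hp.1 j (by push_cast; omega) (by push_cast; omega), hp.2⟩)
      (fun r => by
        obtain ⟨x, y, h1, h2⟩ := hcon r
        exact ⟨(x, y), h1, h2⟩)
      (hcl 0).isCompact hcl
    rw [Set.mem_iInter] at hp
    have : p.1 = p.2 := by
      apply Subtype.ext
      funext j
      exact (hp j.natAbs).1 j (by omega) (by omega)
    exact (hp 0).2 (by rw [this])
  obtain ⟨r, hr⟩ := h0
  refine ⟨r, fun x y i h => ?_⟩
  rcases le_total 0 i with hi | hi
  · obtain ⟨n, rfl⟩ := Int.eq_ofNat_of_zero_le hi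
    have := hr ((shift A)^[n] x) ((shift A)^[n] y) fun j h1 h2 => by
      rw [shift_iterate_apply, shift_iterate_apply]
      exact h _ (by omega) (by omega)
    rw [ShiftAut.comm_pow, ShiftAut.comm_pow, shift_iterate_apply, shift_iterate_apply] at this
    simpa using this
  · obtain ⟨n, hn⟩ := Int.eq_ofNat_of_zero_le (show 0 ≤ -i by omega)
    obtain rfl : i = -(n : ℤ) := by omega
    have hx : ∀ x : X A, ∃ x', (shift A)^[n] x' = x := fun x =>
      (shift A).surjective.iterate n x
    obtain ⟨x', rfl⟩ := hx x
    obtain ⟨y', rfl⟩ := hx y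
    have := hr x' y' fun j h1 h2 => by
      have := h (j - n) (by omega) (by omega)
      rw [shift_iterate_apply, shift_iterate_apply] at this
      simpa using this
    rw [ShiftAut.comm_pow, ShiftAut.comm_pow, shift_iterate_apply, shift_iterate_apply]
    simpa using this

/-- A common range for `φ` and `φ⁻¹`. -/
theorem ShiftAut.exists_range₂ (φ : ShiftAut A) : ∃ r : ℕ,
    (∀ (x y : X A) (i : ℤ),
      (∀ j, i - r ≤ j → j ≤ i + r → x.1 j = y.1 j) → (φ.1 x).1 i = (φ.1 y).1 i) ∧
    (∀ (x y : X A) (i : ℤ),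
      (∀ j, i - r ≤ j → j ≤ i + r → (φ.1 x).1 j = (φ.1 y).1 j) → x.1 i = y.1 i) := by
  obtain ⟨r, hr⟩ := ShiftAut.exists_range φ
  obtain ⟨s, hs⟩ := ShiftAut.exists_range φ⁻¹
  refine ⟨max r s, fun x y i h => hr x y i fun j h1 h2 => h j ?_ ?_, fun x y i h => ?_⟩
  · push_cast; omega
  · push_cast; omega
  · have := hs (φ.1 x) (φ.1 y) i fun j h1 h2 => h j (by push_cast; omega) (by push_cast; omega)
    have e : ∀ z : X A, (φ⁻¹).1 (φ.1 z) = z := fun z => φ.1.symm_apply_apply z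
    rwa [e, e] at this

theorem IsBeam.image_aux {φ : ShiftAut A} {r : ℕ}
    (h1 : ∀ (x y : X A) (i : ℤ),
      (∀ j, i - r ≤ j → j ≤ i + r → x.1 j = y.1 j) → (φ.1 x).1 i = (φ.1 y).1 i)
    (h2 : ∀ (x y : X A) (i : ℤ),
      (∀ j, i - r ≤ j → j ≤ i + r → (φ.1 x).1 j = (φ.1 y).1 j) → x.1 i = y.1 i)
    {m : ℤ} {U : Set (X A)} (hU : IsBeam m U) : IsBeam (m + r) (φ.1 '' U) := by
  have hU0 := isBeam_iff.1 hU
  have hU2 := isBeam_iff.1 (hU.mono (show m ≤ m + r + r by omega))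
  refine isBeam_iff.2 ⟨?_, ?_⟩
  · rintro _ ⟨x, hx, rfl⟩ y hy
    obtain ⟨z, rfl⟩ := φ.1.surjective y
    refine ⟨z, hU0.1 x hx fun i hi => ?_, rfl⟩
    exact h2 z x i fun j _ hj => hy j (by omega)
  · rw [Set.image_image]
    refine (image_finite_and_ncard_le hU2.2 fun x _ y _ hxy => ?_).1
    rw [ray_eq_iff] at hxy ⊢
    intro i hi
    exact h1 x y i fun j _ hj => hxy j (by omega)

theorem IsBeam.image (φ : ShiftAut A) {m : ℤ} {U : Set (X A)} (hU : IsBeam m U) :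
    ∃ n, IsBeam n (φ.1 '' U) := by
  obtain ⟨r, h1, h2⟩ := ShiftAut.exists_range₂ φ
  exact ⟨_, hU.image_aux h1 h2⟩

theorem beamVec_image_le {φ : ShiftAut A} {r : ℕ}
    (h1 : ∀ (x y : X A) (i : ℤ),
      (∀ j, i - r ≤ j → j ≤ i + r → x.1 j = y.1 j) → (φ.1 x).1 i = (φ.1 y).1 i)
    (h2 : ∀ (x y : X A) (i : ℤ),
      (∀ j, i - r ≤ j → j ≤ i + r → (φ.1 x).1 j = (φ.1 y).1 j) → x.1 i = y.1 i)
    {m : ℤ} {U V : Set (X A)} (hU : IsBeam m U) (hV : IsBeam m V)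
    (h : beamVec U m = beamVec V m) (J : Fin k) :
    beamVec (φ.1 '' U) (m + 3 * r + 1) J ≤ beamVec (φ.1 '' V) (m + 3 * r + 1) J := by
  classical
  have hV0 := isBeam_iff.1 hV
  -- an end-state preserving injection from the `m`-rays of `U` to those of `V`
  have hg : ∀ I, ∃ g : Set (X A) → Set (X A),
      Set.MapsTo g (raysIn U m I) (raysIn V m I) ∧ Set.InjOn g (raysIn U m I) := by
    intro I
    have hle : (raysIn U m I).encard ≤ (raysIn V m I).encard := by
      rw [← (hU.finite_raysIn I).cast_ncard_eq, ← (hV.finite_raysIn I).cast_ncard_eq]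
      exact le_of_eq (congrArg _ (congrFun h I))
    by_cases hne : Nonempty (Set (X A))
    · obtain ⟨g, hg1, hg2⟩ := (hU.finite_raysIn I).exists_injOn_of_encard_le hle
      exact ⟨g, hg1, hg2⟩
    · exact (hne ⟨∅⟩).elim
  choose g hg1 hg2 using hg
  have hrep : ∀ z ∈ U, ∃ y ∈ V, (y.1 m).tgt = (z.1 m).tgt ∧
      ray y m = g (z.1 m).tgt (ray z m) := by
    intro z hz
    obtain ⟨y, ⟨hy, hy'⟩, hyr⟩ := hg1 (z.1 m).tgt ⟨z, ⟨hz, rfl⟩, rfl⟩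
    exact ⟨y, hy, hy', hyr⟩
  choose! y hyV hyt hyr using hrep
  let f : X A → X A := fun z => if hz : z ∈ U then glue (y z) z m (hyt z hz) else z
  have hf : ∀ z, ∀ hz : z ∈ U, f z = glue (y z) z m (hyt z hz) := fun z hz => dif_pos hz
  have hfle : ∀ z ∈ U, ∀ i ≤ m, (f z).1 i = (y z).1 i := fun z hz i hi => by
    rw [hf z hz, glue_le _ hi]
  have hfgt : ∀ z ∈ U, ∀ i, m < i → (f z).1 i = z.1 i := fun z hz i hi => by
    rw [hf z hz, glue_gt _ hi]
  have hfV : ∀ z ∈ U, f z ∈ V := fun z hz => hV0.1 _ (hyV z hz) (hfle z hz)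
  have hφf : ∀ z ∈ U, ∀ i, m + r < i → (φ.1 (f z)).1 i = (φ.1 z).1 i := fun z hz i hi =>
    h1 _ _ _ fun j hj _ => hfgt z hz j (by omega)
  set n : ℤ := m + 3 * r + 1 with hn
  have hVn : IsBeam n (φ.1 '' V) := (hV.image_aux h1 h2).mono (by omega)
  have hsub : (fun z => ray (φ.1 (f z)) n) '' {z | z ∈ U ∧ ((φ.1 z).1 n).tgt = J}
      ⊆ raysIn (φ.1 '' V) n J := by
    rintro _ ⟨z, ⟨hz, hJ⟩, rfl⟩
    refine ⟨φ.1 (f z), ⟨⟨f z, hfV z hz, rfl⟩, ?_⟩, rfl⟩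
    rw [hφf z hz n (by omega), hJ]
  have e : raysIn (φ.1 '' U) n J
      = (fun z => ray (φ.1 z) n) '' {z | z ∈ U ∧ ((φ.1 z).1 n).tgt = J} := by
    ext R
    constructor
    · rintro ⟨_, ⟨⟨z, hz, rfl⟩, hJ⟩, rfl⟩
      exact ⟨z, ⟨hz, hJ⟩, rfl⟩
    · rintro ⟨z, ⟨hz, hJ⟩, rfl⟩
      exact ⟨φ.1 z, ⟨⟨z, hz, rfl⟩, hJ⟩, rfl⟩
  rw [beamVec, beamVec, e]
  refine le_trans (image_finite_and_ncard_le ((hVn.finite_raysIn J).subset hsub) ?_).2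
    (Set.ncard_le_ncard hsub (hVn.finite_raysIn J))
  rintro z ⟨hz, -⟩ w ⟨hw, -⟩ hzw
  have hzw : ∀ i ≤ n, (φ.1 (f z)).1 i = (φ.1 (f w)).1 i := ray_eq_iff.1 hzw
  have hff : ∀ i ≤ n - r, (f z).1 i = (f w).1 i := fun i hi =>
    h2 _ _ _ fun j _ hj => hzw j (by omega)
  have hyy : ray (y z) m = ray (y w) m := ray_eq_iff.2 fun i hi => by
    rw [← hfle z hz i hi, ← hfle w hw i hi, hff i (by omega)]
  have htt : (z.1 m).tgt = (w.1 m).tgt := by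
    rw [← hyt z hz, ← hyt w hw, ray_eq_iff.1 hyy m le_rfl]
  have hzwm : ray z m = ray w m := by
    rw [hyr z hz, hyr w hw, htt] at hyy
    exact hg2 _ ⟨z, ⟨hz, htt⟩, rfl⟩ ⟨w, ⟨hw, rfl⟩, rfl⟩ hyy
  have hzwn : ∀ i ≤ n - r, z.1 i = w.1 i := by
    intro i hi
    rcases le_or_gt i m with him | him
    · exact ray_eq_iff.1 hzwm i him
    · rw [← hfgt z hz i him, ← hfgt w hw i him, hff i hi]
  refine ray_eq_iff.2 fun i hi => ?_
  rcases le_or_gt i (n - r - r) with him | him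
  · exact h1 _ _ _ fun j _ hj => hzwn j (by omega)
  · rw [← hφf z hz i (by omega), ← hφf w hw i (by omega), hzw i hi]

theorem BeamEquiv.image (φ : ShiftAut A) {U V : Set (X A)} (h : BeamEquiv U V) :
    BeamEquiv (φ.1 '' U) (φ.1 '' V) := by
  obtain ⟨r, h1, h2⟩ := ShiftAut.exists_range₂ φ
  obtain ⟨m, hU, hV, h⟩ := h
  refine ⟨m + 3 * r + 1, (hU.image_aux h1 h2).mono (by omega),
    (hV.image_aux h1 h2).mono (by omega), ?_⟩
  funext J
  exact le_antisymm (beamVec_image_le h1 h2 hU hV h J) (beamVec_image_le h1 h2 hV hU h.symm J)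

/-! ## Krieger's dimension group `D_A` -/

/-- Beams, i.e. `m`-beams for some `m`. -/
def Beam (A : Matrix (Fin k) (Fin k) ℕ) : Type := {U : Set (X A) // ∃ m, IsBeam m U}

/-- Equivalence of beams. -/
instance beamSetoid (A : Matrix (Fin k) (Fin k) ℕ) [IrredPosEntropy A] : Setoid (Beam A) where
  r U V := BeamEquiv U.1 V.1
  iseqv :=
    ⟨fun U => by
      obtain ⟨m, h⟩ := U.2
      exact ⟨m, h, h, rfl⟩, BeamEquiv.symm, BeamEquiv.trans⟩

/-- The semigroup `D_A⁺` of equivalence classes `[U]` of beams. -/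
def DPlus (A : Matrix (Fin k) (Fin k) ℕ) [IrredPosEntropy A] : Type := Quotient (beamSetoid A)

/-- The equivalence class `[U]` of a beam `U`. -/
def beamClass [IrredPosEntropy A] (U : Beam A) : DPlus A := Quotient.mk (beamSetoid A) U

/-- The union of two beams. -/
def Beam.union (U V : Beam A) : Beam A :=
  ⟨U.1 ∪ V.1, by
    obtain ⟨m, hU⟩ := U.2
    obtain ⟨n, hV⟩ := V.2
    exact ⟨max m n, (hU.mono (le_max_left _ _)).union (hV.mono (le_max_right _ _))⟩⟩

theorem beamClass_eq_iff [IrredPosEntropy A] {U V : Beam A} :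
    beamClass U = beamClass V ↔ BeamEquiv U.1 V.1 := Quotient.eq (r := beamSetoid A)

theorem exists_disjoint_rep [IrredPosEntropy A] (a b : DPlus A) :
    ∃ U V : Beam A, beamClass U = a ∧ beamClass V = b ∧ Disjoint U.1 V.1 := by
  obtain ⟨U, rfl⟩ := Quotient.exists_rep a
  obtain ⟨V, rfl⟩ := Quotient.exists_rep b
  obtain ⟨m, hU⟩ := U.2
  obtain ⟨n, hV⟩ := V.2
  have hU' := hU.mono (le_max_left m n)
  have hV' := hV.mono (le_max_right m n)
  obtain ⟨W, hW, hd, hw⟩ := exists_beam hV' (beamVec U.1 (max m n))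
  exact ⟨⟨W, _, hW⟩, V, beamClass_eq_iff.2 ⟨_, hW, hU', hw⟩, rfl, hd⟩

/-- Addition: `[U] + [V] = [U' ∪ V']`, where `[U] = [U']`, `[V] = [V']` and `U' ∩ V' = ∅`. -/
instance [IrredPosEntropy A] : Add (DPlus A) where
  add a b := beamClass ((exists_disjoint_rep a b).choose.union
    (exists_disjoint_rep a b).choose_spec.choose)

/-- The zero of `D_A⁺` is the class of the empty beam. -/
instance [IrredPosEntropy A] : Zero (DPlus A) where
  zero := beamClass ⟨∅, 0, isBeam_empty 0⟩

theorem beamClass_add [IrredPosEntropy A] {U V : Beam A} (hd : Disjoint U.1 V.1) :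
    beamClass U + beamClass V = beamClass (U.union V) := by
  obtain ⟨h1, h2, h3⟩ := (exists_disjoint_rep (beamClass U) (beamClass V)).choose_spec.choose_spec
  change beamClass (Beam.union _ _) = _
  set U' := (exists_disjoint_rep (beamClass U) (beamClass V)).choose
  set V' := (exists_disjoint_rep (beamClass U) (beamClass V)).choose_spec.choose
  rw [beamClass_eq_iff] at h1 h2 ⊢
  obtain ⟨m, hU', hU, hm⟩ := h1
  obtain ⟨n, hV', hV, hn⟩ := h2
  have hl := le_max_left m n
  have hr := le_max_right m n
  refine ⟨max m n, (hU'.mono hl).union (hV'.mono hr), (hU.mono hl).union (hV.mono hr), ?_⟩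
  change beamVec (U'.1 ∪ V'.1) _ = beamVec (U.1 ∪ V.1) _
  rw [beamVec_union (hU'.mono hl) (hV'.mono hr) h3, beamVec_union (hU.mono hl) (hV.mono hr) hd,
    BeamEquiv.at_ge hU' hU hm hl, BeamEquiv.at_ge hV' hV hn hr]

/-- The vector `v_{U,m}` as an integer vector. -/
def intVec (U : Set (X A)) (m : ℤ) : Fin k → ℤ := fun J => (beamVec U m J : ℤ)

/-- `δ_A^{-k-n}(v_{U,n} Aᵏ)`. -/
def thetaAt (U : Set (X A)) (n : ℤ) : DimGroup A :=
  (delta A ^ (-(k : ℤ) - n)) (ofVec A (intVec U n))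

theorem intVec_succ [IrredPosEntropy A] {m : ℤ} {U : Set (X A)} (hU : IsBeam m U) :
    intVec U (m + 1) = intVec U m ᵥ* A.map (Nat.cast : ℕ → ℤ) := by
  funext J
  rw [intVec, beamVec_succ hU]
  simp [Matrix.vecMul, dotProduct, intVec]

theorem ofVec_coe (v : Fin k → ℤ) :
    (ofVec A v : Fin k → ℚ) = (fun i => (v i : ℚ)) ᵥ* ratMat A ^ k := rfl

theorem ofVec_vecMul (v : Fin k → ℤ) :
    ofVec A (v ᵥ* A.map (Nat.cast : ℕ → ℤ)) = delta A (ofVec A v) := by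
  apply Subtype.ext
  have h := cast_vecMul_pow (A := A) v 1
  rw [pow_one, pow_one] at h
  rw [delta_coe, ofVec_coe, ofVec_coe, ← h, Matrix.vecMul_vecMul, Matrix.vecMul_vecMul, ← pow_succ,
    ← pow_succ']

theorem thetaAt_succ [IrredPosEntropy A] {m : ℤ} {U : Set (X A)} (hU : IsBeam m U) :
    thetaAt U (m + 1) = thetaAt U m := by
  rw [thetaAt, intVec_succ hU, ofVec_vecMul, ← LinearEquiv.mul_apply, ← zpow_add_one, thetaAt]
  congr 2
  ring

theorem thetaAt_ge [IrredPosEntropy A] {m n : ℤ} {U : Set (X A)} (hU : IsBeam m U) (hmn : m ≤ n) :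
    thetaAt U n = thetaAt U m := by
  induction n, hmn using Int.leInduction with
  | base => rfl
  | succ n h ih => rw [thetaAt_succ (hU.mono h), ih]

theorem thetaAt_eq [IrredPosEntropy A] {m n : ℤ} {U : Set (X A)} (hU : IsBeam m U)
    (hU' : IsBeam n U) : thetaAt U m = thetaAt U n := by
  rw [← thetaAt_ge hU (le_max_left m n), ← thetaAt_ge hU' (le_max_right m n)]

/-- The underlying map of `θ : D_A⁺ → G_A`, `θ([U]) = δ_A^{-k-n}(v_{U,n} Aᵏ)` for an `n`-beam `U`. -/
def thetaFun [IrredPosEntropy A] : DPlus A → DimGroup A :=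
  Quotient.lift (fun U : Beam A => thetaAt U.1 U.2.choose) (by
    rintro U V ⟨m, hU, hV, h⟩
    have hv : intVec U.1 m = intVec V.1 m := by
      funext J
      simp only [intVec, h]
    rw [thetaAt_eq U.2.choose_spec hU, thetaAt_eq V.2.choose_spec hV, thetaAt, thetaAt, hv])

theorem thetaFun_beamClass [IrredPosEntropy A] (U : Beam A) {n : ℤ} (hU : IsBeam n U.1) :
    thetaFun (beamClass U) = thetaAt U.1 n := thetaAt_eq U.2.choose_spec hU

theorem thetaFun_injective [IrredPosEntropy A] : Function.Injective (thetaFun (A := A)) := by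
  intro a b hab
  obtain ⟨U, rfl⟩ := Quotient.exists_rep a
  obtain ⟨V, rfl⟩ := Quotient.exists_rep b
  change thetaFun (beamClass U) = thetaFun (beamClass V) at hab
  obtain ⟨m, hU⟩ := U.2
  obtain ⟨n, hV⟩ := V.2
  replace hU := hU.mono (le_max_left m n)
  replace hV := hV.mono (le_max_right m n)
  set p := max m n
  rw [thetaFun_beamClass U hU, thetaFun_beamClass V hV, thetaAt, thetaAt] at hab
  have h := congrArg Subtype.val ((delta A ^ (-(k : ℤ) - p)).injective hab)
  rw [ofVec_coe, ofVec_coe, cast_vecMul_pow, cast_vecMul_pow] at h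
  refine beamClass_eq_iff.2 ⟨p + k, hU.mono (by omega), hV.mono (by omega), ?_⟩
  rw [beamVec_add hU, beamVec_add hV]
  have key : ∀ W : Set (X A), ∀ i, ((intVec W p ᵥ* (A.map (Nat.cast : ℕ → ℤ)) ^ k) i)
      = (((beamVec W p ᵥ* A ^ k) i : ℕ) : ℤ) := by
    intro W i
    have h := RingHom.map_vecMul (Nat.castRingHom ℤ) (A ^ k) (beamVec W p) i
    have h2 : (A ^ k).map (Nat.castRingHom ℤ) = (A.map (Nat.cast : ℕ → ℤ)) ^ k := by
      rw [Matrix.map_pow]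
      rfl
    rw [h2] at h
    exact h.symm
  funext i
  have hi := congrFun h i
  rw [key, key] at hi
  exact_mod_cast hi

theorem thetaFun_add [IrredPosEntropy A] (a b : DPlus A) :
    thetaFun (a + b) = thetaFun a + thetaFun b := by
  obtain ⟨U, V, rfl, rfl, hd⟩ := exists_disjoint_rep a b
  obtain ⟨m, hU⟩ := U.2
  obtain ⟨n, hV⟩ := V.2
  replace hU := hU.mono (le_max_left m n)
  replace hV := hV.mono (le_max_right m n)
  rw [beamClass_add hd, thetaFun_beamClass (U.union V) (hU.union hV), thetaFun_beamClass U hU,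
    thetaFun_beamClass V hV, thetaAt, thetaAt, thetaAt, ← map_add, ← map_add]
  congr 2
  funext J
  simp only [Pi.add_apply, intVec]
  rw [show (U.union V).1 = U.1 ∪ V.1 from rfl, beamVec_union hU hV hd, Pi.add_apply, Nat.cast_add]

theorem thetaFun_zero [IrredPosEntropy A] : thetaFun (0 : DPlus A) = 0 := by
  have h := thetaFun_beamClass (A := A) ⟨∅, 0, isBeam_empty 0⟩ (isBeam_empty 0)
  refine h.trans ?_
  have h0 : intVec (∅ : Set (X A)) 0 = 0 := by
    funext J
    simp [intVec, beamVec_empty]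
  rw [thetaAt, h0, map_zero, map_zero]

/-- `D_A⁺` is a commutative monoid. -/
instance [IrredPosEntropy A] : AddCommMonoid (DPlus A) where
  add_assoc a b c := thetaFun_injective (by simp only [thetaFun_add, add_assoc])
  zero_add a := thetaFun_injective (by simp only [thetaFun_add, thetaFun_zero, zero_add])
  add_zero a := thetaFun_injective (by simp only [thetaFun_add, thetaFun_zero, add_zero])
  add_comm a b := thetaFun_injective (by simp only [thetaFun_add, add_comm])
  nsmul := nsmulRec

/-- Krieger's dimension group `D_A`, the group completion of `D_A⁺`. -/
abbrev KriegerGroup (A : Matrix (Fin k) (Fin k) ℕ) [IrredPosEntropy A] : Type :=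
  Algebra.GrothendieckAddGroup (DPlus A)

/-- The homomorphism `θ : D_A⁺ → G_A`. -/
def thetaPlus (A : Matrix (Fin k) (Fin k) ℕ) [IrredPosEntropy A] : DPlus A →+ DimGroup A where
  toFun := thetaFun
  map_zero' := thetaFun_zero
  map_add' := thetaFun_add

/-- The homomorphism `θ : D_A → G_A` induced on group completions. -/
def thetaHom (A : Matrix (Fin k) (Fin k) ℕ) [IrredPosEntropy A] :
    KriegerGroup A →+ DimGroup A := Algebra.GrothendieckAddGroup.lift (thetaPlus A)

theorem thetaHom_of [IrredPosEntropy A] (a : DPlus A) :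
    thetaHom A (Algebra.GrothendieckAddGroup.of a) = thetaPlus A a :=
  DFunLike.congr_fun (Algebra.GrothendieckAddGroup.lift.symm_apply_apply (thetaPlus A)) a

theorem krieger_exists_sub [IrredPosEntropy A] (x : KriegerGroup A) :
    ∃ a b : DPlus A, x =
      Algebra.GrothendieckAddGroup.of a - Algebra.GrothendieckAddGroup.of b := by
  obtain ⟨⟨a, b⟩, h⟩ := (AddLocalization.addMonoidOf (⊤ : AddSubmonoid (DPlus A))).surj x
  exact ⟨a, b.1, eq_sub_of_add_eq h⟩

/-- For a nonnegative integer vector `w`, the element `δ_A^{-k-n}(w Aᵏ)` is in the image of `θ`. -/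
theorem exists_thetaPlus_eq [IrredPosEntropy A] (w : Fin k → ℕ) (n : ℤ) :
    ∃ a, thetaPlus A a = (delta A ^ (-(k : ℤ) - n)) (ofVec A fun i => (w i : ℤ)) := by
  obtain ⟨U, hU, -, hw⟩ := exists_beam (isBeam_empty (A := A) n) w
  refine ⟨beamClass ⟨U, n, hU⟩, (thetaFun_beamClass ⟨U, n, hU⟩ hU).trans ?_⟩
  have hv : intVec U n = fun i => (w i : ℤ) := by
    funext i
    simp only [intVec, hw]
  rw [thetaAt, hv]

theorem eq_delta_zpow {x : DimGroup A} {n : ℕ} {z : Fin k → ℤ}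
    (hz : (x : Fin k → ℚ) ᵥ* ratMat A ^ n = fun i => (z i : ℚ)) :
    x = (delta A ^ (-(k : ℤ) - (n : ℤ))) (ofVec A z) := by
  have h : ofVec A z = (delta A ^ (k + n)) x := by
    apply Subtype.ext
    rw [ofVec_coe, delta_pow_coe, ← hz, Matrix.vecMul_vecMul, ← pow_add, add_comm]
  rw [h, ← zpow_natCast, ← LinearEquiv.mul_apply, ← zpow_add]
  simp

theorem thetaHom_bijective (A : Matrix (Fin k) (Fin k) ℕ) [IrredPosEntropy A] :
    Function.Bijective (thetaHom A) := by
  constructor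
  · rw [injective_iff_map_eq_zero]
    intro x hx
    obtain ⟨a, b, rfl⟩ := krieger_exists_sub x
    rw [map_sub, thetaHom_of, thetaHom_of, sub_eq_zero] at hx
    rw [thetaFun_injective hx, sub_self]
  · intro x
    obtain ⟨n, z, hz⟩ := x.2.2
    obtain ⟨a, ha⟩ := exists_thetaPlus_eq (A := A) (fun i => (z i).toNat) n
    obtain ⟨b, hb⟩ := exists_thetaPlus_eq (A := A) (fun i => (-z i).toNat) n
    refine ⟨Algebra.GrothendieckAddGroup.of a - Algebra.GrothendieckAddGroup.of b, ?_⟩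
    rw [map_sub, thetaHom_of, thetaHom_of, ha, hb, ← map_sub, ← map_sub, eq_delta_zpow hz]
    congr 2
    funext i
    simp only [Pi.sub_apply]
    omega

/-- The isomorphism `θ : D_A → G_A`. -/
def theta (A : Matrix (Fin k) (Fin k) ℕ) [IrredPosEntropy A] : KriegerGroup A ≃+ DimGroup A :=
  AddEquiv.ofBijective (thetaHom A) (thetaHom_bijective A)

/-! ## The dimension representation -/

/-- The image `φ(U)` of a beam. -/
def Beam.image (φ : ShiftAut A) (U : Beam A) : Beam A :=
  ⟨φ.1 '' U.1, by
    obtain ⟨m, h⟩ := U.2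
    exact h.image φ⟩

/-- `φ_* : D_A⁺ → D_A⁺`, `φ_*([U]) = [φ(U)]`. -/
def pushPlus [IrredPosEntropy A] (φ : ShiftAut A) : DPlus A →+ DPlus A where
  toFun := Quotient.map (Beam.image φ) fun _ _ h => BeamEquiv.image φ h
  map_zero' := by
    change beamClass (Beam.image φ ⟨∅, 0, isBeam_empty 0⟩) = beamClass ⟨∅, 0, isBeam_empty 0⟩
    congr 1
    apply Subtype.ext
    simp [Beam.image]
  map_add' a b := by
    obtain ⟨U, V, rfl, rfl, hd⟩ := exists_disjoint_rep a b
    rw [beamClass_add hd]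
    change beamClass (Beam.image φ (U.union V))
      = beamClass (Beam.image φ U) + beamClass (Beam.image φ V)
    rw [beamClass_add ((Set.disjoint_image_iff φ.1.injective).2 hd)]
    congr 1
    apply Subtype.ext
    exact Set.image_union _ _ _

theorem pushPlus_beamClass [IrredPosEntropy A] (φ : ShiftAut A) (U : Beam A) :
    pushPlus φ (beamClass U) = beamClass (Beam.image φ U) := rfl

/-- `φ_* : D_A → D_A`. -/
def push [IrredPosEntropy A] (φ : ShiftAut A) : KriegerGroup A →+ KriegerGroup A :=
  Algebra.GrothendieckAddGroup.lift (Algebra.GrothendieckAddGroup.of.comp (pushPlus φ))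

theorem push_of [IrredPosEntropy A] (φ : ShiftAut A) (a : DPlus A) :
    push φ (Algebra.GrothendieckAddGroup.of a) = Algebra.GrothendieckAddGroup.of (pushPlus φ a) :=
  DFunLike.congr_fun (Algebra.GrothendieckAddGroup.lift.symm_apply_apply
    (Algebra.GrothendieckAddGroup.of.comp (pushPlus φ))) a

theorem pushPlus_one [IrredPosEntropy A] (a : DPlus A) : pushPlus (1 : ShiftAut A) a = a := by
  obtain ⟨U, rfl⟩ := Quotient.exists_rep a
  change beamClass (Beam.image 1 U) = beamClass U
  congr 1
  apply Subtype.ext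
  exact Set.image_id U.1

theorem pushPlus_mul [IrredPosEntropy A] (φ ψ : ShiftAut A) (a : DPlus A) :
    pushPlus (φ * ψ) a = pushPlus φ (pushPlus ψ a) := by
  obtain ⟨U, rfl⟩ := Quotient.exists_rep a
  change beamClass (Beam.image (φ * ψ) U) = beamClass (Beam.image φ (Beam.image ψ U))
  congr 1
  apply Subtype.ext
  exact Set.image_comp φ.1 ψ.1 U.1

theorem push_one [IrredPosEntropy A] (x : KriegerGroup A) : push (1 : ShiftAut A) x = x := by
  obtain ⟨a, b, rfl⟩ := krieger_exists_sub x
  rw [map_sub, push_of, push_of, pushPlus_one, pushPlus_one]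

theorem push_mul [IrredPosEntropy A] (φ ψ : ShiftAut A) (x : KriegerGroup A) :
    push (φ * ψ) x = push φ (push ψ x) := by
  obtain ⟨a, b, rfl⟩ := krieger_exists_sub x
  simp only [map_sub, push_of, pushPlus_mul]

/-- `φ_*` as an automorphism of the group `D_A`. -/
def pushEquiv [IrredPosEntropy A] (φ : ShiftAut A) : KriegerGroup A ≃+ KriegerGroup A where
  toFun := push φ
  invFun := push φ⁻¹
  left_inv x := by rw [← push_mul, inv_mul_cancel, push_one]
  right_inv x := by rw [← push_mul, mul_inv_cancel, push_one]
  map_add' := map_add _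

/-- `S_φ = θ ∘ φ_* ∘ θ⁻¹`, as an automorphism of the group `G_A`. -/
def dimAction [IrredPosEntropy A] (φ : ShiftAut A) : DimGroup A ≃ₗ[ℤ] DimGroup A :=
  (((theta A).symm.trans (pushEquiv φ)).trans (theta A)).toIntLinearEquiv

theorem dimAction_theta [IrredPosEntropy A] (φ : ShiftAut A) (x : KriegerGroup A) :
    dimAction φ (theta A x) = theta A (push φ x) := by
  change theta A (push φ ((theta A).symm (theta A x))) = _
  rw [AddEquiv.symm_apply_apply]

theorem dimAction_thetaPlus [IrredPosEntropy A] (φ : ShiftAut A) (a : DPlus A) :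
    dimAction φ (thetaPlus A a) = thetaPlus A (pushPlus φ a) := by
  rw [← thetaHom_of, ← thetaHom_of, ← push_of]
  exact dimAction_theta φ _

theorem dimAction_mul [IrredPosEntropy A] (φ ψ : ShiftAut A) :
    dimAction (φ * ψ) = dimAction φ * dimAction ψ := by
  ext1 x
  obtain ⟨y, rfl⟩ := (theta A).surjective x
  rw [LinearEquiv.mul_apply, dimAction_theta, dimAction_theta, dimAction_theta, push_mul]

theorem dimAction_one [IrredPosEntropy A] : dimAction (1 : ShiftAut A) = 1 := by
  ext1 x
  obtain ⟨y, rfl⟩ := (theta A).surjective x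
  rw [dimAction_theta, push_one]
  rfl

theorem ofVec_nat_mem_dimPos (w : Fin k → ℕ) (n : ℤ) :
    (delta A ^ n) (ofVec A fun i => (w i : ℤ)) ∈ dimPos A := by
  refine ⟨n.natAbs, w ᵥ* A ^ (n + n.natAbs + k).toNat, ?_⟩
  rw [← delta_pow_coe, ← LinearEquiv.mul_apply, ← zpow_natCast, ← zpow_add]
  obtain ⟨p, hp⟩ := Int.eq_ofNat_of_zero_le (show 0 ≤ (n.natAbs : ℤ) + n by omega)
  rw [hp, zpow_natCast, delta_pow_coe, ofVec_coe, Matrix.vecMul_vecMul, ← pow_add,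
    show (n + n.natAbs + k).toNat = k + p by omega]
  have h := RingHom.map_vecMul (Nat.castRingHom ℚ) (A ^ (k + p)) w
  have h2 : (A ^ (k + p)).map (Nat.castRingHom ℚ) = ratMat A ^ (k + p) := by
    rw [Matrix.map_pow]
    rfl
  rw [h2] at h
  funext i
  refine Eq.trans ?_ (h i).symm
  congr 1

/-- `θ(D_A⁺) = G_A⁺`. -/
theorem range_thetaPlus [IrredPosEntropy A] : Set.range (thetaPlus A) = dimPos A := by
  apply Set.Subset.antisymm
  · rintro _ ⟨a, rfl⟩
    obtain ⟨U, rfl⟩ := Quotient.exists_rep a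
    exact ofVec_nat_mem_dimPos (beamVec U.1 _) _
  · rintro x ⟨n, w, hw⟩
    obtain ⟨a, ha⟩ := exists_thetaPlus_eq (A := A) w n
    refine ⟨a, ha.trans (eq_delta_zpow ?_).symm⟩
    rw [hw]
    funext i
    simp

/-- The shift as an automorphism of itself. -/
def shiftAut (A : Matrix (Fin k) (Fin k) ℕ) : ShiftAut A :=
  ⟨shift A, Subgroup.mem_centralizer_singleton_iff.2 rfl⟩

theorem shift_image_aux {m : ℤ} {U : Set (X A)} (hU : IsBeam (m + 1) U) :
    IsBeam m (shift A '' U) ∧ ∀ J, raysIn (shift A '' U) m J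
      = (fun R => shift A '' R) '' raysIn U (m + 1) J := by
  have hray : ∀ x : X A, ray (shift A x) m = shift A '' ray x (m + 1) := by
    intro x
    ext y
    constructor
    · intro h
      refine ⟨(shift A).symm y, fun i hi => ?_, (shift A).apply_symm_apply y⟩
      rw [shift_symm_apply, h (i - 1) (by omega), shift_apply, sub_add_cancel]
    · rintro ⟨z, hz, rfl⟩ i hi
      rw [shift_apply, shift_apply, hz _ (by omega)]
  constructor
  · obtain ⟨s, hs, rfl⟩ := hU
    refine ⟨shift A '' s, hs.image _, ?_⟩
    rw [Set.image_iUnion₂, Set.biUnion_image]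
    simp only [hray]
  · intro J
    ext R
    constructor
    · rintro ⟨_, ⟨⟨x, hx, rfl⟩, hJ⟩, rfl⟩
      exact ⟨_, ⟨x, ⟨hx, hJ⟩, rfl⟩, (hray x).symm⟩
    · rintro ⟨_, ⟨x, ⟨hx, hJ⟩, rfl⟩, rfl⟩
      exact ⟨shift A x, ⟨⟨x, hx, rfl⟩, hJ⟩, hray x⟩

/-- `θ ∘ d_A = δ_A ∘ θ`, where `d_A([U]) = [σ_A(U)]`. -/
theorem thetaPlus_shift [IrredPosEntropy A] (a : DPlus A) :
    thetaPlus A (pushPlus (shiftAut A) a) = delta A (thetaPlus A a) := by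
  obtain ⟨U, rfl⟩ := Quotient.exists_rep a
  obtain ⟨m, hU⟩ := U.2
  have h1 : IsBeam (m - 1 + 1) U.1 := by rwa [sub_add_cancel]
  obtain ⟨h2, h3⟩ := shift_image_aux h1
  refine (thetaFun_beamClass (Beam.image (shiftAut A) U) h2).trans ?_
  refine Eq.trans ?_ (congrArg (delta A) (thetaFun_beamClass U hU).symm)
  have hv : intVec (Beam.image (shiftAut A) U).1 (m - 1) = intVec U.1 m := by
    funext J
    rw [intVec, intVec, beamVec, beamVec]
    rw [show raysIn (Beam.image (shiftAut A) U).1 (m - 1) J = _ from h3 J, sub_add_cancel,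
      Set.InjOn.ncard_image]
    exact ((Set.image_injective.2 (shift A).injective)).injOn
  rw [thetaAt, thetaAt, hv, ← LinearEquiv.mul_apply, ← zpow_one_add]
  congr 2
  ring

theorem dimAction_shift [IrredPosEntropy A] : dimAction (shiftAut A) = delta A := by
  ext1 x
  obtain ⟨y, rfl⟩ := (theta A).surjective x
  obtain ⟨a, b, rfl⟩ := krieger_exists_sub y
  have h : ∀ c : DPlus A, theta A (Algebra.GrothendieckAddGroup.of c) = thetaPlus A c :=
    thetaHom_of
  rw [map_sub, h, h, map_sub, map_sub, dimAction_thetaPlus, dimAction_thetaPlus, thetaPlus_shift,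
    thetaPlus_shift]

theorem dimAction_mem [IrredPosEntropy A] (φ : ShiftAut A) : dimAction φ ∈ DimAut A := by
  constructor
  · have hsub : ∀ ψ : ShiftAut A, dimAction ψ '' dimPos A ⊆ dimPos A := by
      intro ψ
      rw [← range_thetaPlus]
      rintro _ ⟨_, ⟨a, rfl⟩, rfl⟩
      exact ⟨_, (dimAction_thetaPlus ψ a).symm⟩
    refine Set.Subset.antisymm (hsub φ) fun x hx => ?_
    refine ⟨dimAction φ⁻¹ x, hsub φ⁻¹ ⟨x, hx, rfl⟩, ?_⟩
    rw [← LinearEquiv.mul_apply, ← dimAction_mul, mul_inv_cancel, dimAction_one]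
    rfl
  · rw [← dimAction_shift, ← dimAction_mul, ← dimAction_mul]
    congr 1
    exact Subtype.ext (Subgroup.mem_centralizer_singleton_iff.1 φ.2)

/-- The dimension representation `π_A : Aut(σ_A) → Aut(G_A, G_A⁺, δ_A)`, `φ ↦ S_φ`. -/
def dimRep (A : Matrix (Fin k) (Fin k) ℕ) [IrredPosEntropy A] : ShiftAut A →* DimAut A where
  toFun φ := ⟨dimAction φ, dimAction_mem φ⟩
  map_one' := Subtype.ext dimAction_one
  map_mul' φ ψ := Subtype.ext (dimAction_mul φ ψ)

end EdgeShift

end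

namespace EdgeShift

variable {k : ℕ} {A : Matrix (Fin k) (Fin k) ℕ}

open Filter

/-! ## Coding of left half-lines -/

/-! An eigenvalue of modulus greater than one would make some vector of $\mathcal G_A\otimes\mathbb
C$ grow exponentially under $S_\phi$. Distortion forbids this: $\phi^n$ moves the left half-line by
only $o(n)$ in either direction, so it changes the level and the number of rays of a beam by
subexponential amounts.

Quantitatively, fix $N$. Since $\alpha^-(\phi)=\alpha^-(\phi^{-1})=0$, for all large $n$ both
$\phi^n$ and $\phi^{-n}$ code $(-\infty,-p]$ from $(-\infty,0]$, with $p=\lfloor n/N\rfloor$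
(`HasLyapunovMinus.eventually_codes`). Let $U$ be an $m$-beam with $c$ rays. Coding by $\phi^n$
shows that $\phi^n(U)$ meets at most $c$ rays of level $m-p$, hence at most $c|E|^{2p}$ rays of
level $m+p$, where $E$ is the set of edges. Coding by $\phi^{-n}$ shows that $\phi^n(U)$ is a union
of rays of that level (`IsBeam.image_of_codes`). Evaluating $\theta$ there costs a further factor
$K^p$ for the power of $\delta_A^{-1}$ (`exists_norm_thetaAt_le`), so $\|S_\phi^n\theta([U])\|\le
C(K|E|^2)^p$. As $N$ is arbitrary, this is $O(r^n)$ for every $r>1$ (`growthLE_thetaPlus`).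

The bound passes to differences of classes, hence to $\mathcal G_A$, and to finite sums of pure
tensors, hence to the complexification. There `complexCoords` embeds the space in $\mathbb C^k$ and
supplies the norm. An eigenvector for $\mu$ then forces $|\mu|\le 1$ (`norm_eigenvalue_le_one`).
Applying this to $\phi$ and to $\phi^{-1}$, for which the same vector has eigenvalue $\mu^{-1}$,
gives $|\mu|=1$. -/

theorem shift_zpow_apply (m : ℤ) (x : X A) (i : ℤ) : ((shift A ^ m) x).1 i = x.1 (i + m) := by
  induction m generalizing x with
  | zero => simp
  | succ n ih =>
    rw [zpow_add_one, Homeomorph.mul_apply, ih, shift_apply, add_assoc]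
  | pred n ih =>
    rw [zpow_sub_one, Homeomorph.mul_apply, ih]
    change ((shift A).symm x).1 (i + -(n : ℤ)) = _
    rw [shift_symm_apply, add_sub_assoc]

theorem ShiftAut.comm_zpow (φ : ShiftAut A) (m : ℤ) (x : X A) :
    φ.1 ((shift A ^ m) x) = (shift A ^ m) (φ.1 x) := by
  have h : Commute φ.1 (shift A) := (Subgroup.mem_centralizer_singleton_iff.1 φ.2)
  exact congrArg (fun f : X A ≃ₜ X A => f x) (h.zpow_right m).eq

/-- Coding of left half-lines is shift invariant. -/
theorem Codes.eq_of_le {φ : ShiftAut A} {p : ℤ} (h : Codes φ.1 (Set.Iic 0) (Set.Iic (-p)))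
    {m : ℤ} {x y : X A} (hxy : ∀ i ≤ m, x.1 i = y.1 i) :
    ∀ i ≤ m - p, (φ.1 x).1 i = (φ.1 y).1 i := by
  intro i hi
  -- Translate by $\sigma^m$, which brings coordinate $m$ to the origin and commutes with $\phi$.
  have := h ((shift A ^ m) x) ((shift A ^ m) y) (fun j hj => by
    rw [shift_zpow_apply, shift_zpow_apply]
    exact hxy _ (by have : j ≤ 0 := hj; omega)) (i - m) (show i - m ≤ -p by omega)
  rwa [ShiftAut.comm_zpow, ShiftAut.comm_zpow, shift_zpow_apply, shift_zpow_apply,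
    sub_add_cancel] at this

/-- If `α⁻(φ) = 0`, then `(-∞, 0]` `φⁿ`-codes `(-∞, -⌊n / N⌋]` for all large `n`. -/
theorem HasLyapunovMinus.eventually_codes {φ : ShiftAut A} (h : HasLyapunovMinus φ 0) {N : ℕ}
    (hN : 0 < N) :
    ∀ᶠ n : ℕ in atTop, Codes (φ ^ n : ShiftAut A).1 (Set.Iic 0) (Set.Iic (-((n / N : ℕ) : ℤ))) := by
  have hneg : ((-(1 / (N : ℝ)) : ℝ) : EReal) < 0 := by
    have : -(1 / (N : ℝ)) < 0 := by
      have : (0 : ℝ) < N := by exact_mod_cast hN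
      have := one_div_pos.2 this
      linarith
    exact_mod_cast this
  filter_upwards [h.eventually_const_lt hneg, eventually_gt_atTop 0] with n hn hn0
  have hn' : ((n : ℝ) : EReal) = (n : EReal) := rfl
  -- Clearing the denominator in the extended reals needs $0<n<\infty$. The strict inequality below
  -- the supremum then produces an actual integer $m\in C^-(\phi^n)$ with $-n/N<m$, whether or not
  -- the supremum is finite.
  rw [EReal.lt_div_iff (by exact_mod_cast hn0) (by exact EReal.natCast_ne_top n), ← hn',
    ← EReal.coe_mul, WMinus, lt_sSup_iff] at hn
  obtain ⟨_, ⟨m, hm, rfl⟩, hlt⟩ := hn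
  beta_reduce at hlt
  have hlt : -(1 / (N : ℝ)) * n < m := by exact_mod_cast hlt
  have hN' : (0 : ℝ) < N := by exact_mod_cast hN
  have hlt' : -(n : ℝ) < m * N := by
    have := mul_lt_mul_of_pos_right hlt hN'
    have e : -(1 / (N : ℝ)) * n * N = -n := by field_simp
    linarith
  have hlt'' : -(n : ℤ) < m * N := by exact_mod_cast hlt'
  -- Integrality turns $-m<n/N$ into $-m\le\lfloor n/N\rfloor$. Coding up to $m$ then implies coding
  -- up to the smaller bound.
  have hle : -((n / N : ℕ) : ℤ) ≤ m := by
    have : -m ≤ (n : ℤ) / N := by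
      rw [Int.le_ediv_iff_mul_le (by exact_mod_cast hN)]
      linarith
    push_cast
    linarith
  intro x y hxy j hj
  exact hm x y hxy j (le_trans hj hle)

/-! ## Counting rays -/

/-- Extending a ray by one coordinate amounts to choosing one more edge, so each level multiplies
the count by at most the size of the alphabet. The set `V` is not assumed to be a beam: the lemma is
applied to $\phi(U)$ starting at level $m-p$, where $\phi(U)$ need not be a union of rays. -/
theorem finite_ray_image_add {m : ℤ} {V : Set (X A)} (h : ((fun x => ray x m) '' V).Finite)
    (n : ℕ) : ((fun x => ray x (m + n)) '' V).Finite ∧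
      ((fun x => ray x (m + n)) '' V).ncard
        ≤ ((fun x => ray x m) '' V).ncard * Nat.card (Edge A) ^ n := by
  induction n with
  | zero => simpa using h
  | succ n ih =>
    obtain ⟨hf, hc⟩ := ih
    have hsub : ((fun x : X A => (ray x (m + n), x.1 (m + n + 1))) '' V)
        ⊆ ((fun x => ray x (m + n)) '' V) ×ˢ (Set.univ : Set (Edge A)) := by
      rintro _ ⟨x, hx, rfl⟩
      exact ⟨⟨x, hx, rfl⟩, trivial⟩
    have hfin := hf.prod (Set.finite_univ (α := Edge A))
    obtain ⟨h1, h2⟩ := image_finite_and_ncard_le (hfin.subset hsub)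
      fun x _ y _ hxy => (ray_succ_iff x y (m + n)).1 hxy
    have hle := h2.trans (Set.ncard_le_ncard hsub hfin)
    rw [Set.ncard_prod, Set.ncard_univ] at hle
    rw [Nat.cast_succ, ← add_assoc]
    refine ⟨h1, hle.trans ?_⟩
    rw [pow_succ, ← mul_assoc]
    exact Nat.mul_le_mul_right _ hc

theorem beamVec_le_ncard {m : ℤ} {U : Set (X A)} (hU : IsBeam m U) (J : Fin k) :
    beamVec U m J ≤ ((fun x => ray x m) '' U).ncard :=
  Set.ncard_le_ncard (Set.image_mono fun _ hx => hx.1) (isBeam_iff.1 hU).2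

/-- If `φ` and `φ⁻¹` move the left half-line by at most `p`, then the image under `φ` of an
`m`-beam `U` is an `(m + p)`-beam with at most `|U| · |E|²ᵖ` rays. -/
theorem IsBeam.image_of_codes {φ : ShiftAut A} {p : ℕ}
    (h : Codes φ.1 (Set.Iic 0) (Set.Iic (-(p : ℤ))))
    (h' : Codes (φ⁻¹ : ShiftAut A).1 (Set.Iic 0) (Set.Iic (-(p : ℤ))))
    {m : ℤ} {U : Set (X A)} (hU : IsBeam m U) :
    IsBeam (m + p) (φ.1 '' U) ∧ ∀ J, beamVec (φ.1 '' U) (m + p) J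
      ≤ ((fun x => ray x m) '' U).ncard * Nat.card (Edge A) ^ (2 * p) := by
  obtain ⟨h1, h2⟩ := isBeam_iff.1 hU
  -- The $(m-p)$-ray of $\phi(x)$ depends only on the $m$-ray of $x$, so $\phi(U)$ meets no more
  -- $(m-p)$-rays than $U$ has $m$-rays.
  obtain ⟨hf, hc⟩ := image_finite_and_ncard_le (f := fun x => ray (φ.1 x) (m - p)) h2
    fun x _ y _ hxy => ray_eq_iff.2 (h.eq_of_le (ray_eq_iff.1 hxy))
  rw [← Set.image_image (fun x => ray x (m - p)) φ.1] at hf hc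
  -- Going from level $m-p$ to level $m+p$ adds $2p$ coordinates.
  obtain ⟨hf', hc'⟩ := finite_ray_image_add hf (2 * p)
  rw [show m - p + ((2 * p : ℕ) : ℤ) = m + p by push_cast; ring] at hf' hc'
  have hb : IsBeam (m + p) (φ.1 '' U) := by
    refine isBeam_iff.2 ⟨?_, hf'⟩
    rintro _ ⟨x, hx, rfl⟩ y hy
    have e : ∀ z : X A, (φ⁻¹).1 (φ.1 z) = z := fun z => φ.1.symm_apply_apply z
    -- If $y$ agrees with $\phi(x)$ up to $m+p$, coding by $\phi^{-1}$ makes $\phi^{-1}(y)$ agree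
    -- with $x$ up to $m$, so it lies in the beam $U$.
    refine ⟨(φ⁻¹).1 y, h1 x hx fun i hi => ?_, φ.1.apply_symm_apply y⟩
    have := h'.eq_of_le hy i (by omega)
    rwa [e] at this
  exact ⟨hb, fun J => (beamVec_le_ncard hb J).trans (hc'.trans (Nat.mul_le_mul_right _ hc))⟩

/-! ## Norm bounds on the dimension group -/

/-- The constant is read off from the images of the standard basis vectors. The extra summand $1$
ensures $K\ge1$, so that later powers of the constant increase with the exponent. -/
theorem exists_norm_le (f : (Fin k → ℚ) →ₗ[ℚ] (Fin k → ℚ)) :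
    ∃ K : ℝ, 1 ≤ K ∧ ∀ x, ‖f x‖ ≤ K * ‖x‖ := by
  refine ⟨1 + ∑ i, ‖f (Pi.single i 1)‖, ?_, fun x => ?_⟩
  · have : 0 ≤ ∑ i, ‖f (Pi.single i 1)‖ := Finset.sum_nonneg fun _ _ => norm_nonneg _
    linarith
  · rw [LinearMap.pi_apply_eq_sum_univ f x]
    calc ‖∑ i, x i • f (fun j => if i = j then 1 else 0)‖
        ≤ ∑ i, ‖f (Pi.single i 1)‖ * ‖x‖ := by
          refine norm_sum_le_of_le _ fun i _ => ?_
          have e : (fun j => if i = j then (1 : ℚ) else 0) = Pi.single i 1 := by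
            funext j
            simp [Pi.single_apply, eq_comm]
          rw [e, norm_smul, mul_comm]
          exact mul_le_mul_of_nonneg_left (norm_le_pi_norm x i) (norm_nonneg _)
      _ ≤ (1 + ∑ i, ‖f (Pi.single i 1)‖) * ‖x‖ := by
          rw [← Finset.sum_mul]
          gcongr
          linarith

/-- The matrix $A$ may be singular, but it is injective on $R(A)$. A linear left inverse of its
restriction to $R(A)$, defined on all of $\mathbb Q^k$, is bounded and controls $\delta_A^{-1}$. A
common bound for $\delta_A$ and $\delta_A^{-1}$ then iterates. -/
theorem exists_norm_delta_zpow_le (A : Matrix (Fin k) (Fin k) ℕ) :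
    ∃ K : ℝ, 1 ≤ K ∧ ∀ (z : ℤ) (g : DimGroup A),
      ‖((delta A ^ z) g : Fin k → ℚ)‖ ≤ K ^ z.natAbs * ‖(g : Fin k → ℚ)‖ := by
  let T : eventualRange A →ₗ[ℚ] (Fin k → ℚ) :=
    (Matrix.vecMulLinear (ratMat A)).comp (eventualRange A).subtype
  obtain ⟨L, hL⟩ := T.exists_leftInverse_of_injective
    (LinearMap.ker_eq_bot'.2 fun x hx => Subtype.ext (eventualRange_inj x.2 hx))
  obtain ⟨K₁, hK₁, h₁⟩ := exists_norm_le (Matrix.vecMulLinear (ratMat A))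
  obtain ⟨K₂, hK₂, h₂⟩ := exists_norm_le ((eventualRange A).subtype.comp L)
  have hpos : ∀ g : DimGroup A,
      ‖(delta A g : Fin k → ℚ)‖ ≤ max K₁ K₂ * ‖(g : Fin k → ℚ)‖ := fun g =>
    (h₁ g).trans (mul_le_mul_of_nonneg_right (le_max_left _ _) (norm_nonneg _))
  have hneg : ∀ g : DimGroup A,
      ‖((delta A)⁻¹ g : Fin k → ℚ)‖ ≤ max K₁ K₂ * ‖(g : Fin k → ℚ)‖ := by
    intro g
    obtain ⟨g, rfl⟩ := (delta A).surjective g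
    have e : (delta A)⁻¹ (delta A g) = g := (delta A).symm_apply_apply g
    have e' : L (delta A g : Fin k → ℚ) = ⟨g.1, g.2.1⟩ :=
      LinearMap.congr_fun hL (⟨g.1, g.2.1⟩ : eventualRange A)
    have := h₂ (delta A g : Fin k → ℚ)
    rw [LinearMap.comp_apply, e'] at this
    rw [e]
    exact this.trans (mul_le_mul_of_nonneg_right (le_max_right _ _) (norm_nonneg _))
  have hK : 1 ≤ max K₁ K₂ := hK₁.trans (le_max_left _ _)
  have hpow : ∀ Φ : DimGroup A ≃ₗ[ℤ] DimGroup A,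
      (∀ g, ‖(Φ g : Fin k → ℚ)‖ ≤ max K₁ K₂ * ‖(g : Fin k → ℚ)‖) →
      ∀ (n : ℕ) (g : DimGroup A),
        ‖((Φ ^ n) g : Fin k → ℚ)‖ ≤ max K₁ K₂ ^ n * ‖(g : Fin k → ℚ)‖ := by
    intro Φ hΦ n
    induction n with
    | zero => simp
    | succ n ih =>
      intro g
      rw [pow_succ', LinearEquiv.mul_apply, pow_succ', mul_assoc]
      exact (hΦ _).trans (mul_le_mul_of_nonneg_left (ih g) (by linarith))
  refine ⟨max K₁ K₂, hK, fun z g => ?_⟩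
  obtain ⟨n, rfl | rfl⟩ := Int.eq_nat_or_neg z
  · simpa using hpow _ hpos n g
  · simpa using hpow _ hneg n g

/-- In $\delta_A^{-k-m}(vA^k)$ the power of $\delta_A$ costs at most $K^{k+|m|}$ and the matrix
$A^k$ one further factor $K$. The point is that the dependence on the level $m$ is only exponential
in $|m|$. -/
theorem exists_norm_thetaAt_le (A : Matrix (Fin k) (Fin k) ℕ) :
    ∃ K : ℝ, 1 ≤ K ∧ ∀ (m : ℤ) (U : Set (X A)) (B : ℝ), 0 ≤ B → (∀ J, (beamVec U m J : ℝ) ≤ B) →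
      ‖(thetaAt U m : Fin k → ℚ)‖ ≤ K ^ (k + 1 + m.natAbs) * B := by
  obtain ⟨K₁, hK₁, h₁⟩ := exists_norm_delta_zpow_le A
  obtain ⟨K₂, hK₂, h₂⟩ := exists_norm_le (Matrix.vecMulLinear (ratMat A ^ k))
  refine ⟨max K₁ K₂, hK₁.trans (le_max_left _ _), fun m U B hB hv => ?_⟩
  have hnorm : ‖(fun i => (intVec U m i : ℚ))‖ ≤ B := by
    refine (pi_norm_le_iff_of_nonneg hB).2 fun J => ?_
    rw [intVec, Int.cast_natCast]
    refine le_trans (le_of_eq ?_) (hv J)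
    rw [← Rat.norm_cast_real, Rat.cast_natCast, Real.norm_natCast]
  have hof : ‖(ofVec A (intVec U m) : Fin k → ℚ)‖ ≤ max K₁ K₂ * B :=
    (h₂ _).trans (mul_le_mul (le_max_right _ _) hnorm (norm_nonneg _) (by positivity))
  have hexp : (-(k : ℤ) - m).natAbs ≤ k + m.natAbs := by omega
  calc ‖(thetaAt U m : Fin k → ℚ)‖
      ≤ K₁ ^ (-(k : ℤ) - m).natAbs * ‖(ofVec A (intVec U m) : Fin k → ℚ)‖ := h₁ _ _
    _ ≤ max K₁ K₂ ^ (k + m.natAbs) * (max K₁ K₂ * B) := by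
        refine mul_le_mul ?_ hof (norm_nonneg _) (by positivity)
        exact (pow_le_pow_right₀ hK₁ hexp).trans
          (pow_le_pow_left₀ (by linarith) (le_max_left _ _) _)
    _ = max K₁ K₂ ^ (k + 1 + m.natAbs) * B := by ring

/-! ## Subexponential growth -/

/-- The orbit of `g` under `Φ` grows at most like `rⁿ`, measured by `ν`. -/
def GrowthLE {M : Type*} (ν : M → ℝ) (Φ : M → M) (r : ℝ) (g : M) : Prop :=
  ∃ C : ℝ, ∀ᶠ n : ℕ in atTop, ν (Φ^[n] g) ≤ C * r ^ n

theorem dimAction_pow [IrredPosEntropy A] (φ : ShiftAut A) (n : ℕ) :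
    dimAction (φ ^ n) = dimAction φ ^ n := by
  induction n with
  | zero => rw [pow_zero, pow_zero, dimAction_one]
  | succ n ih => rw [pow_succ, pow_succ, dimAction_mul, ih]

/-- With $p=\lfloor n/N\rfloor$, the class of $\phi^n(U)$ is evaluated at level $m+p$. The shift in
level costs $K^p$ and the count of rays $|E|^{2p}$. Since $p\le n/N$ with $N$ at our disposal, the
product grows more slowly than any prescribed $r^n$ with $r>1$. -/
theorem growthLE_thetaPlus [IrredPosEntropy A] {φ : ShiftAut A} (h : HasLyapunovMinus φ 0)
    (h' : HasLyapunovMinus φ⁻¹ 0) {r : ℝ} (hr : 1 < r) (a : DPlus A) :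
    GrowthLE (fun g : DimGroup A => ‖(g : Fin k → ℚ)‖) (dimAction φ) r (thetaPlus A a) := by
  obtain ⟨U, rfl⟩ := Quotient.exists_rep a
  obtain ⟨m, hU⟩ := U.2
  obtain ⟨K, hK, hθ⟩ := exists_norm_thetaAt_le A
  set c := ((fun x => ray x m) '' U.1).ncard
  set E := Nat.card (Edge A)
  -- $N$ is chosen so that $K|E|^2\le r^N$, whence $(K|E|^2)^p\le r^{Np}\le r^n$. Passing from `N₀`
  -- to `N₀ + 1` makes $N$ positive.
  obtain ⟨N₀, hN₀⟩ := pow_unbounded_of_one_lt (K * E ^ 2) hr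
  set N := N₀ + 1
  have hN : K * E ^ 2 ≤ r ^ N := hN₀.le.trans (pow_le_pow_right₀ hr.le (Nat.le_succ _))
  refine ⟨K ^ (k + 1 + m.natAbs) * c, ?_⟩
  filter_upwards [h.eventually_codes (Nat.succ_pos N₀), h'.eventually_codes (Nat.succ_pos N₀)]
    with n hn hn'
  rw [inv_pow] at hn'
  set p := n / N
  obtain ⟨hb, hv⟩ := hU.image_of_codes hn hn'
  -- The value of $\theta$ does not depend on the level at which a beam is read, so the level $m+p$
  -- just obtained may be used.
  have e : (dimAction φ)^[n] (thetaPlus A (beamClass U))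
      = thetaAt ((φ ^ n : ShiftAut A).1 '' U.1) (m + p) := by
    rw [← LinearEquiv.coe_pow, ← dimAction_pow, dimAction_thetaPlus, pushPlus_beamClass]
    exact thetaFun_beamClass (Beam.image (φ ^ n) U) hb
  change ‖((dimAction φ)^[n] (thetaPlus A (beamClass U)) : Fin k → ℚ)‖ ≤ _
  rw [e]
  refine (hθ _ _ (c * E ^ (2 * p)) (by positivity) fun J => by exact_mod_cast hv J).trans ?_
  have hK0 : 0 < K := by linarith
  calc K ^ (k + 1 + (m + p).natAbs) * (c * (E : ℝ) ^ (2 * p))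
      ≤ K ^ (k + 1 + m.natAbs + p) * (c * (E : ℝ) ^ (2 * p)) := by
        refine mul_le_mul_of_nonneg_right (pow_le_pow_right₀ hK ?_) (by positivity)
        have := Int.natAbs_add_le m p
        rw [Int.natAbs_natCast] at this
        linarith
    _ = K ^ (k + 1 + m.natAbs) * c * (K * E ^ 2) ^ p := by ring
    _ ≤ K ^ (k + 1 + m.natAbs) * c * r ^ n := by
        gcongr
        calc (K * (E : ℝ) ^ 2) ^ p ≤ (r ^ N) ^ p := by gcongr
          _ = r ^ (N * p) := (pow_mul _ _ _).symm
          _ ≤ r ^ n := pow_le_pow_right₀ hr.le (Nat.mul_div_le n N)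

/-! ## The complexified dimension group -/

open scoped TensorProduct

/-- The map `ℂ ⊗ G_A → ℂᵏ`, `c ⊗ x ↦ c x`. -/
noncomputable def complexCoords (A : Matrix (Fin k) (Fin k) ℕ) : ℂ ⊗[ℤ] DimGroup A →ₗ[ℤ] (Fin k → ℂ) :=
  ((TensorProduct.piScalarRight ℚ ℚ ℂ (Fin k)).toLinearMap.restrictScalars ℤ).comp
    (((IsLocalization.moduleTensorEquiv (nonZeroDivisors ℤ) ℚ ℂ
      (Fin k → ℚ)).symm.toLinearMap.restrictScalars ℤ).comp
        (LinearMap.lTensor ℂ (dimSubgroup A).subtype.toIntLinearMap))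

theorem complexCoords_tmul (c : ℂ) (g : DimGroup A) :
    complexCoords A (c ⊗ₜ g) = fun i => (g : Fin k → ℚ) i • c := by
  change (TensorProduct.piScalarRight ℚ ℚ ℂ (Fin k)) ((IsLocalization.moduleTensorEquiv
    (nonZeroDivisors ℤ) ℚ ℂ (Fin k → ℚ)).symm (c ⊗ₜ (g : Fin k → ℚ))) = _
  -- Tensor products over $\mathbb Z$ and over $\mathbb Q$ of rational vector spaces agree, and the
  -- identification is the identity on pure tensors.
  have e : (IsLocalization.moduleTensorEquiv (nonZeroDivisors ℤ) ℚ ℂ (Fin k → ℚ)).symm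
      (c ⊗ₜ (g : Fin k → ℚ)) = c ⊗ₜ (g : Fin k → ℚ) := by
    rw [LinearEquiv.symm_apply_eq]
    rfl
  rw [e]
  simp

/-- The coordinate map is assembled as a $\mathbb Z$-linear map. Its homogeneity over $\mathbb C$ is
what lets $|\mu|^n$ be read off from the orbit of an eigenvector. -/
theorem complexCoords_smul (c : ℂ) (w : ℂ ⊗[ℤ] DimGroup A) :
    complexCoords A (c • w) = c • complexCoords A w := by
  induction w with
  | zero => simp
  | tmul d g =>
    rw [TensorProduct.smul_tmul', complexCoords_tmul, complexCoords_tmul]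
    funext i
    simp
  | add v w hv hw => rw [smul_add, map_add, map_add, hv, hw, smul_add]

/-- $\mathbb C$ is flat over $\mathbb Z$, so the inclusion $\mathcal G_A\subset\mathbb Q^k$ stays
injective after tensoring, and the remaining maps are isomorphisms. Hence the norm of the
coordinates is a genuine norm on $\mathcal G_A\otimes\mathbb C$. -/
theorem complexCoords_injective (A : Matrix (Fin k) (Fin k) ℕ) :
    Function.Injective (complexCoords A) := by
  refine (TensorProduct.piScalarRight ℚ ℚ ℂ (Fin k)).injective.comp
    ((IsLocalization.moduleTensorEquiv (nonZeroDivisors ℤ) ℚ ℂ (Fin k → ℚ)).symm.injective.comp ?_)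
  exact Module.Flat.lTensor_preserves_injective_linearMap _ Subtype.val_injective

theorem norm_complexCoords_tmul_le (c : ℂ) (g : DimGroup A) :
    ‖complexCoords A (c ⊗ₜ g)‖ ≤ ‖c‖ * ‖(g : Fin k → ℚ)‖ := by
  rw [complexCoords_tmul]
  refine (pi_norm_le_iff_of_nonneg (by positivity)).2 fun i => ?_
  rw [Rat.smul_def, norm_mul, mul_comm]
  refine mul_le_mul_of_nonneg_left ?_ (norm_nonneg _)
  refine le_trans (le_of_eq ?_) (norm_le_pi_norm (g : Fin k → ℚ) i)
  rw [← Rat.norm_cast_real, ← Complex.norm_real, Complex.ofReal_ratCast]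

theorem baseChange_iterate_tmul (Φ : DimGroup A →ₗ[ℤ] DimGroup A) (n : ℕ) (c : ℂ)
    (g : DimGroup A) : (Φ.baseChange ℂ)^[n] (c ⊗ₜ g) = c ⊗ₜ Φ^[n] g := by
  induction n with
  | zero => rfl
  | succ n ih =>
    rw [Function.iterate_succ_apply', Function.iterate_succ_apply', ih, LinearMap.baseChange_tmul]

/-- The constant in `GrowthLE` may depend on the vector, so the vectors of growth rate at most $r$
are closed under sums and scalar multiples. Pure tensors therefore suffice. -/
theorem growthLE_baseChange {Φ : DimGroup A →ₗ[ℤ] DimGroup A} {r : ℝ}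
    (h : ∀ g, GrowthLE (fun g : DimGroup A => ‖(g : Fin k → ℚ)‖) Φ r g) (w : ℂ ⊗[ℤ] DimGroup A) :
    GrowthLE (fun w => ‖complexCoords A w‖) (Φ.baseChange ℂ) r w := by
  induction w with
  | zero =>
    refine ⟨0, Eventually.of_forall fun n => ?_⟩
    simp
  | tmul c g =>
    obtain ⟨C, hC⟩ := h g
    refine ⟨‖c‖ * C, hC.mono fun n hn => ?_⟩
    rw [baseChange_iterate_tmul, mul_assoc]
    exact (norm_complexCoords_tmul_le _ _).trans (mul_le_mul_of_nonneg_left hn (norm_nonneg _))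
  | add v w hv hw =>
    obtain ⟨C, hC⟩ := hv
    obtain ⟨D, hD⟩ := hw
    refine ⟨C + D, ?_⟩
    filter_upwards [hC, hD] with n h1 h2
    rw [← Module.End.coe_pow] at h1 h2 ⊢
    rw [map_add, map_add, add_mul]
    exact (norm_add_le _ _).trans (add_le_add h1 h2)

/-! ### Subexponential growth on the whole dimension group and the bound on eigenvalues -/

/-- Every element of $\mathcal G_A$ is a difference of two elements of $\theta(D_A^+)$, so the
triangle inequality reduces the claim to classes of beams. -/
theorem growthLE_dimAction [IrredPosEntropy A] {φ : ShiftAut A} (h : HasLyapunovMinus φ 0)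
    (h' : HasLyapunovMinus φ⁻¹ 0) {r : ℝ} (hr : 1 < r) (g : DimGroup A) :
    GrowthLE (fun g : DimGroup A => ‖(g : Fin k → ℚ)‖) (dimAction φ) r g := by
  obtain ⟨x, rfl⟩ := (theta A).surjective g
  obtain ⟨a, b, rfl⟩ := krieger_exists_sub x
  obtain ⟨C, hC⟩ := growthLE_thetaPlus h h' hr a
  obtain ⟨D, hD⟩ := growthLE_thetaPlus h h' hr b
  refine ⟨C + D, ?_⟩
  filter_upwards [hC, hD] with n h1 h2
  have e : ∀ c : DPlus A, theta A (Algebra.GrothendieckAddGroup.of c) = thetaPlus A c := thetaHom_of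
  rw [← LinearEquiv.coe_pow] at h1 h2 ⊢
  rw [map_sub, e, e, map_sub, add_mul]
  exact (norm_sub_le _ _).trans (add_le_add h1 h2)

/-- If `α⁻(φ) = α⁻(φ⁻¹) = 0`, then no eigenvalue of `S_φ` has modulus greater than one. -/
theorem norm_eigenvalue_le_one [IrredPosEntropy A] {φ : ShiftAut A} (h : HasLyapunovMinus φ 0)
    (h' : HasLyapunovMinus φ⁻¹ 0) {μ : ℂ} {w : ℂ ⊗[ℤ] DimGroup A} (hw : w ≠ 0)
    (hμ : (dimAction φ).toLinearMap.baseChange ℂ w = μ • w) : ‖μ‖ ≤ 1 := by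
  by_contra! hlt
  -- With $1<r<|\mu|$, the orbit of $w$ has norm exactly $|\mu|^n\|w\|$ but is $O(r^n)$, which fails
  -- once $(|\mu|/r)^n$ exceeds $C/\|w\|$.
  obtain ⟨r, hr, hrμ⟩ := exists_between hlt
  obtain ⟨C, hC⟩ := growthLE_baseChange (Φ := (dimAction φ).toLinearMap)
    (fun g => growthLE_dimAction h h' hr g) w
  have hiter : ∀ n : ℕ, ((dimAction φ).toLinearMap.baseChange ℂ)^[n] w = μ ^ n • w := by
    intro n
    induction n with
    | zero => simp
    | succ n ih =>
      rw [Function.iterate_succ_apply', ih, map_smul, hμ, smul_smul, pow_succ]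
  have hpos : 0 < ‖complexCoords A w‖ := norm_pos_iff.2 fun h0 =>
    hw (complexCoords_injective A (h0.trans (map_zero _).symm))
  have hr0 : 0 < r := by linarith
  have hlim : Tendsto (fun n : ℕ => (‖μ‖ / r) ^ n) atTop atTop :=
    tendsto_pow_atTop_atTop_of_one_lt ((one_lt_div hr0).2 hrμ)
  obtain ⟨n, hn, hn'⟩ := (hC.and (hlim.eventually_gt_atTop (C / ‖complexCoords A w‖))).exists
  beta_reduce at hn
  rw [hiter, complexCoords_smul, norm_smul, norm_pow] at hn
  rw [div_pow, div_lt_div_iff₀ hpos (by positivity)] at hn'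
  linarith

end EdgeShift

/-! ### The theorem: the bound applied to $\phi$ and to $\phi^{-1}$ -/

theorem theorem4p2 {k : ℕ} (A : Matrix (Fin k) (Fin k) ℕ) [EdgeShift.IrredPosEntropy A]
    (φ : EdgeShift.ShiftAut A)
    (hφ : EdgeShift.RangeDistorted φ) (hφinv : EdgeShift.RangeDistorted φ⁻¹)
    (μ : ℂ)
    (hμ : Module.End.HasEigenvalue
      (LinearMap.baseChange ℂ (EdgeShift.dimRep A φ).1.toLinearMap) μ) :
    ‖μ‖ = 1 := by
  obtain ⟨w, hw⟩ := hμ.exists_hasEigenvector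
  have hw1 : (EdgeShift.dimAction φ).toLinearMap.baseChange ℂ w = μ • w := hw.apply_eq_smul
  -- $S_{\phi^{-1}}$ inverts $S_\phi$. This shows first that $\mu\ne0$, and then that $w$ is an
  -- eigenvector of $S_{\phi^{-1}}$ for $\mu^{-1}$.
  have hinv : (EdgeShift.dimAction φ⁻¹).toLinearMap.baseChange ℂ (μ • w) = w := by
    rw [← hw1, ← LinearMap.comp_apply, ← LinearMap.baseChange_comp]
    have : (EdgeShift.dimAction φ⁻¹).toLinearMap ∘ₗ (EdgeShift.dimAction φ).toLinearMap
        = LinearMap.id := by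
      ext1 g
      change (EdgeShift.dimAction φ⁻¹ * EdgeShift.dimAction φ) g = g
      rw [← EdgeShift.dimAction_mul, inv_mul_cancel, EdgeShift.dimAction_one]
      rfl
    rw [this, LinearMap.baseChange_id, LinearMap.id_apply]
  have hμ0 : μ ≠ 0 := by
    rintro rfl
    rw [zero_smul, map_zero] at hinv
    exact hw.2 hinv.symm
  have hw2 : (EdgeShift.dimAction φ⁻¹).toLinearMap.baseChange ℂ w = μ⁻¹ • w := by
    rw [map_smul] at hinv
    rw [← hinv, smul_smul, inv_mul_cancel₀ hμ0, one_smul, hinv]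
  refine le_antisymm (EdgeShift.norm_eigenvalue_le_one hφ.1 hφinv.1 hw.2 hw1) ?_
  -- The assumptions are symmetric in $\phi$ and $\phi^{-1}$, so the same bound gives
  -- $|\mu^{-1}|\le1$.
  have h := EdgeShift.norm_eigenvalue_le_one hφinv.1 (by rw [inv_inv]; exact hφ.1) hw.2 hw2
  rw [norm_inv] at h
  exact (inv_le_one₀ (norm_pos_iff.2 hμ0)).1 h
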